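/- Let $n\ge 2$ be an integer, put $$\gamma(p,n)=2+(n+1)p-(n-1)p^2,\qquad p_0(n)=\frac{n+1+\sqrt{n^2+10n-7}}{2(n-1)},$$ so that $p_0(n)$ is the positive root of $\gamma(p,n)=0$, and let $1<p<p_0(n)$ and $R>0$. Let $f\in H^1(\mathbb R^n)$ be real-valued, non-negative and not identically zero. For $\varepsilon>0$ consider the initial value problem $$u_{tt}-\Delta u=|u|^p,\qquad u(x,0)=\varepsilon f(x),\qquad u_t(x,0)=0 .\tag{1}$$ For $0<T<\infty$, a solution of (1) on $[0,T)$ is a real-valued function $u$ with $$(u,u_t)\in C\bigl([0,T),H^1(\mathbb R^n)\times L^2(\mathbb R^n)\bigr),\qquad |u|^p\in L^1_{\rm loc}(\mathbb R^n\times[0,T)),$$ $$\operatorname{supp}(u,u_t)\subset\{(x,t)\in\mathbb R^n\times[0,\infty): |x|\le t+R\},$$ which satisfies the equation in the sense of distributions on $\mathbb R^n\times(0,T)$ and has the initial values $u(\cdot,0)=\varepsilon f$ and $u_t(\cdot,0)=0$. Let the lifespan $T(\varepsilon)\in[0,\infty]$ be the supremum of all $T>0$ for which (1) has a solution on $[0,T)$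 (it is $0$ if there is none). Then there exist constants $\varepsilon_1>0$ and $C>0$, depending only on $f,n,p,R$ (in particular not on $\varepsilon$), such that $$T(\varepsilon)\le C\,\varepsilon^{-2p(p-1)/\gamma(p,n)}\qquad\text{for all } 0<\varepsilon\le\varepsilon_1 .$$ -/

import Mathlib

open MeasureTheory Set
open scoped ENNReal ContDiff

namespace SemilinearWave

noncomputable section

/-- The quadratic `γ(p,n) = 2 + (n+1) p - (n-1) p²`. -/
def gamma (p : ℝ) (n : ℕ) : ℝ := 2 + ((n : ℝ) + 1) * p - ((n : ℝ) - 1) * p ^ 2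

/-- The Strauss exponent `p₀(n)`, i.e. the positive root of `γ(p,n) = 0` (for `n ≥ 2`). -/
def straussExponent (n : ℕ) : ℝ :=
  ((n : ℝ) + 1 + Real.sqrt ((n : ℝ) ^ 2 + 10 * n - 7)) / (2 * ((n : ℝ) - 1))

/-- `ℝⁿ` with the Euclidean norm. -/
abbrev Space (n : ℕ) := EuclideanSpace ℝ (Fin n)

/-- The real Hilbert space `L²(ℝⁿ)`. -/
abbrev L2 (n : ℕ) := Lp ℝ 2 (volume : Measure (Space n))

/-- `G = (G₁, …, Gₙ)`, with components in `L²(ℝⁿ)`, is the weak gradient of `w ∈ L²(ℝⁿ)`: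
`∫ w ∂ᵢφ = - ∫ Gᵢ φ` for all `φ ∈ C_c^∞(ℝⁿ)` and all `i`. -/
def IsWeakGradient {n : ℕ} (w : L2 n) (G : Fin n → L2 n) : Prop :=
  ∀ (i : Fin n) (φ : Space n → ℝ), ContDiff ℝ ∞ φ → HasCompactSupport φ →
    ∫ x, w x * fderiv ℝ φ x (EuclideanSpace.single i 1) = -∫ x, G i x * φ x

/-- `w ∈ H¹(ℝⁿ)`. -/
def MemH1 {n : ℕ} (w : L2 n) : Prop := ∃ G : Fin n → L2 n, IsWeakGradient w G

/-- `w ∈ C([0,T), H¹(ℝⁿ))`: every `w(t)` is in `H¹(ℝⁿ)`, and `w` and its weak gradient are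
continuous in time with values in `L²(ℝⁿ)`. -/
def ContinuousH1 {n : ℕ} (w : ℝ → L2 n) (T : ℝ) : Prop :=
  ContinuousOn w (Ico 0 T) ∧
    ∃ G : ℝ → Fin n → L2 n, (∀ t ∈ Ico 0 T, IsWeakGradient (w t) (G t)) ∧
      ∀ i, ContinuousOn (fun t => G t i) (Ico 0 T)

/-- `|w|^p` is locally integrable on `ℝⁿ × [0,T)`. -/
def LocallyIntegrablePower {n : ℕ} (p : ℝ) (w : ℝ → L2 n) (T : ℝ) : Prop :=
  ∀ S ∈ Ico 0 T, ∀ K : Set (Space n), IsCompact K →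
    ∫⁻ t in Icc 0 S, ∫⁻ x in K, ‖w t x‖ₑ ^ p < ⊤

/-- `u_tt - Δu = |u|^p` in the sense of distributions on `ℝⁿ × (0,T)`:
`∫∫ u (φ_tt - Δφ) dx dt = ∫∫ |u|^p φ dx dt` for all test functions
`φ ∈ C_c^∞((0,T) × ℝⁿ)`. -/
def SolvesWeakly {n : ℕ} (p : ℝ) (u : ℝ → L2 n) (T : ℝ) : Prop :=
  ∀ φ : ℝ × Space n → ℝ, ContDiff ℝ ∞ φ → HasCompactSupport φ →
    tsupport φ ⊆ Ioo 0 T ×ˢ univ →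
    ∫ t in Ioo 0 T, ∫ x, u t x *
        (iteratedDeriv 2 (fun s => φ (s, x)) t - Laplacian.laplacian (fun y => φ (t, y)) x)
      = ∫ t in Ioo 0 T, ∫ x, |u t x| ^ p * φ (t, x)

/-- `u` is a solution on `[0,T)`, with time derivative `v = u_t`, of
`u_tt - Δu = |u|^p`, `u(·,0) = ε f`, `u_t(·,0) = ε g`, such that
`(u,u_t) ∈ C([0,T), H¹(ℝⁿ) × L²(ℝⁿ))` and `supp (u,u_t) ⊆ {(x,t) : |x| ≤ t + R}`. -/
structure IsSolution {n : ℕ} (p R : ℝ) (f g : L2 n) (ε T : ℝ) (u v : ℝ → L2 n) : Prop where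
  continuous_u : ContinuousH1 u T
  continuous_v : ContinuousOn v (Ico 0 T)
  deriv_u : ∀ t ∈ Ico 0 T, HasDerivWithinAt u (v t) (Ico 0 T) t
  initial_u : u 0 = ε • f
  initial_v : v 0 = ε • g
  locallyIntegrable : LocallyIntegrablePower p u T
  equation : SolvesWeakly p u T
  support : ∀ t ∈ Ico 0 T, ∀ᵐ x : Space n, t + R < ‖x‖ → u t x = 0 ∧ v t x = 0

/-- The lifespan `T(ε)`, in `[0,∞]`: the supremum of all `T > 0` for which the initial value
problem has a solution on `[0,T)`. -/
def lifespan {n : ℕ} (p R : ℝ) (f g : L2 n) (ε : ℝ) : ℝ≥0∞ :=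
  sSup (ENNReal.ofReal '' {T : ℝ | 0 < T ∧ ∃ u v : ℝ → L2 n, IsSolution p R f g ε T u v})

end

end SemilinearWave

namespace SemilinearWave

noncomputable section

/-!
The equation is tested against `θ(t) ψ(x)` with `ψ > 0` an eigenfunction of the Laplacian,
`Δψ = cψ`. A solution with compactly supported time slices then satisfies
`∫₀^τ (∫uψ)(θ'' - cθ) = ∫₀^τ (∫|u|^p ψ) θ + ε (∫gψ) θ(0) - ε (∫fψ) θ'(0)`
as soon as `θ(τ) = θ'(τ) = 0`. Let `q = p/(p-1)`, let `η` be a cutoff equal to `1` at `0` and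
vanishing to high order at `τ`, and put `X = ∫₀^τ (∫|u|^p) η`.

* For `ψ = 1` and `θ = η`, Young's inequality absorbs the left-hand side into `X`, so that
  `X ≤ C τ^(n+1-2q)`.
* For `ψ = φ` the radial solution of `Δφ = φ` and `θ = e^{-t} η`, the terms without derivatives of
  `η` cancel. The product `e^{-t} φ(x)` is of size `(1+t)^{-(n-1)/2}` near the light cone, so its
  `L^q` norm over the support of `u(t)` gives
  `ε (∫fφ + ∫gφ) ≤ λ^p X / p + C λ^{-q} τ^(1-q+(n-1)(1-q/2))` for every `λ > 0`.

Inserting the first bound into the second and optimising in `λ` yields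
`ε (∫fφ + ∫gφ) ≤ K τ^{-γ(p,n)/(2p(p-1))}` for all `1 ≤ τ < T`, which bounds `T`.
-/

section PowerSeries

variable {a : ℕ → ℝ}

lemma hasDerivAt_tsum_mul_pow
    (ha : ∀ r : ℝ, Summable fun k : ℕ => ((k : ℝ) + 1) * a (k + 1) * r ^ k) (s : ℝ) :
    HasDerivAt (fun y => ∑' k, a k * y ^ k) (∑' k : ℕ, ((k : ℝ) + 1) * a (k + 1) * s ^ k) s := by
  set M := |s| + 1
  have hM : 0 < M := by positivity
  have shift : ∀ r : ℝ, (fun k : ℕ => a (k + 1) * (((k + 1 : ℕ) : ℝ) * r ^ (k + 1 - 1)))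
      = fun k : ℕ => ((k : ℝ) + 1) * a (k + 1) * r ^ k := fun r => by
    ext k
    rw [Nat.add_sub_cancel]
    push_cast
    ring
  have summable_deriv : ∀ r : ℝ, Summable fun k : ℕ => a k * (k * r ^ (k - 1)) := fun r =>
    (summable_nat_add_iff 1).1 (shift r ▸ ha r)
  have h := hasDerivAt_tsum_of_isPreconnected (𝕜 := ℝ) (t := Metric.ball (0 : ℝ) M)
    (g := fun k y => a k * y ^ k) (g' := fun k y => a k * (k * y ^ (k - 1)))
    (summable_deriv M).norm Metric.isOpen_ball (convex_ball _ _).isPreconnected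
    (fun k y _ => (hasDerivAt_pow k y).const_mul _)
    (fun k y hy => by
      have hy' : |y| ≤ |M| := by
        rw [abs_of_pos hM]
        exact (mem_ball_zero_iff.1 hy).le
      simp only [norm_mul, norm_pow, Real.norm_eq_abs]
      gcongr)
    (Metric.mem_ball_self hM) (summable_of_ne_finset_zero (s := {0}) fun k hk => by simp_all)
    (by simp [M] : s ∈ Metric.ball (0 : ℝ) M)
  rwa [(summable_deriv s).tsum_eq_zero_add, Nat.cast_zero, zero_mul, mul_zero, zero_add,
    shift s] at h

lemma sq_tsum_le_tsum_mul_tsum {f g : ℕ → ℝ} (ha : Summable a) (hf : Summable f)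
    (hg : Summable g) (hf0 : ∀ k, 0 ≤ f k) (hg0 : ∀ k, 0 ≤ g k)
    (h : ∀ k, a k ^ 2 ≤ f k * g k) : (∑' k, a k) ^ 2 ≤ (∑' k, f k) * ∑' k, g k :=
  le_of_tendsto' (ha.hasSum.tendsto_sum_nat.pow 2) fun N =>
    calc (∑ k ∈ Finset.range N, a k) ^ 2
        ≤ (∑ k ∈ Finset.range N, f k) * ∑ k ∈ Finset.range N, g k :=
          Finset.sum_sq_le_sum_mul_sum_of_sq_le_mul _ (fun k _ => hf0 k) (fun k _ => hg0 k)
            fun k _ => h k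
      _ ≤ (∑' k, f k) * ∑' k, g k := by
          gcongr
          · exact Finset.sum_nonneg fun k _ => hg0 k
          · exact tsum_nonneg hf0
          · exact hf.sum_le_tsum _ fun k _ => hf0 k
          · exact hg.sum_le_tsum _ fun k _ => hg0 k

end PowerSeries

lemma summable_pow_div_factorial_two_mul_add (r : ℝ) (d : ℕ) :
    Summable fun k : ℕ => r ^ (2 * k + d) / (2 * k + d).factorial :=
  (Real.summable_pow_div_factorial r).comp_injective (i := fun k => 2 * k + d)
    fun i j (h : 2 * i + d = 2 * j + d) => by omega

lemma tsum_pow_div_factorial_two_mul_add_le_exp {r : ℝ} (hr : 0 ≤ r) (d : ℕ) :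
    ∑' k : ℕ, r ^ (2 * k + d) / (2 * k + d).factorial ≤ Real.exp r := by
  rw [Real.exp_eq_exp_ℝ, NormedSpace.exp_eq_tsum_div]
  exact tsum_comp_le_tsum_of_inj (Real.summable_pow_div_factorial r) (fun k => by positivity)
    (i := fun k => 2 * k + d) fun i j (h : 2 * i + d = 2 * j + d) => by omega

section Bessel

variable {m : ℝ}

/-- The Taylor coefficients of `besselSeries m`, read off its differential equation. -/
def besselCoeff (m : ℝ) (k : ℕ) : ℝ := ∏ j ∈ Finset.range k, ((2 * (j : ℝ) + 2) * (2 * j + m))⁻¹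

/-- The entire solution of `4 s h'' + 2 m h' = h` with `h 0 = 1`. It is a modified Bessel
function: `besselSeries m (r ^ 2) = Γ(m / 2) (r / 2) ^ (1 - m / 2) I_{m / 2 - 1}(r)`. -/
def besselSeries (m s : ℝ) : ℝ := ∑' k, besselCoeff m k * s ^ k

lemma besselCoeff_nonneg (hm : 0 < m) (k : ℕ) : 0 ≤ besselCoeff m k :=
  Finset.prod_nonneg fun _ _ => by positivity

@[simp] lemma besselCoeff_zero (m : ℝ) : besselCoeff m 0 = 1 := by simp [besselCoeff]

lemma besselCoeff_succ (m : ℝ) (k : ℕ) :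
    besselCoeff m (k + 1) = besselCoeff m k * ((2 * (k : ℝ) + 2) * (2 * k + m))⁻¹ :=
  Finset.prod_range_succ _ _

lemma besselCoeff_add_two_mul (hm : 0 < m) (k : ℕ) :
    besselCoeff (m + 2) k * (2 * k + m) = m * besselCoeff m k := by
  induction k with
  | zero => simp
  | succ k ih =>
    rw [besselCoeff_succ, besselCoeff_succ, ← mul_assoc, ← ih]
    push_cast
    field_simp
    ring

lemma succ_mul_besselCoeff_succ (hm : 0 < m) (k : ℕ) :
    ((k : ℝ) + 1) * besselCoeff m (k + 1) = besselCoeff (m + 2) k / (2 * m) := by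
  have h := besselCoeff_add_two_mul hm k
  rw [besselCoeff_succ]
  field_simp
  linear_combination -h

lemma besselCoeff_le (hm : 0 < m) (k : ℕ) :
    besselCoeff m k ≤ (2 * m)⁻¹ ^ k / k.factorial := by
  induction k with
  | zero => simp
  | succ k ih =>
    calc besselCoeff m (k + 1)
        = besselCoeff m k * ((2 * (k : ℝ) + 2) * (2 * k + m))⁻¹ := besselCoeff_succ m k
      _ ≤ (2 * m)⁻¹ ^ k / k.factorial * ((2 * (k : ℝ) + 2) * (2 * 0 + m))⁻¹ := by
          gcongr
          positivity
      _ = (2 * m)⁻¹ ^ (k + 1) / (k + 1).factorial := by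
          rw [Nat.factorial_succ, pow_succ]
          push_cast
          field_simp
          ring

lemma summable_besselCoeff_mul_pow (hm : 0 < m) (s : ℝ) :
    Summable fun k => besselCoeff m k * s ^ k := by
  refine .of_norm_bounded (Real.summable_pow_div_factorial ((2 * m)⁻¹ * |s|)) fun k => ?_
  rw [norm_mul, norm_pow, Real.norm_of_nonneg (besselCoeff_nonneg hm k), Real.norm_eq_abs,
    mul_pow, mul_div_right_comm]
  gcongr
  exact besselCoeff_le hm k

lemma hasDerivAt_besselSeries (hm : 0 < m) (s : ℝ) :
    HasDerivAt (besselSeries m) (besselSeries (m + 2) s / (2 * m)) s := by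
  have coeff : ∀ r : ℝ, (fun k : ℕ => ((k : ℝ) + 1) * besselCoeff m (k + 1) * r ^ k)
      = fun k => besselCoeff (m + 2) k * r ^ k / (2 * m) := fun r => by
    ext k
    rw [succ_mul_besselCoeff_succ hm, mul_div_right_comm]
  have h := hasDerivAt_tsum_mul_pow (a := besselCoeff m) (fun r => coeff r ▸
    (summable_besselCoeff_mul_pow (by positivity) r).div_const _) s
  rwa [coeff s, tsum_div_const] at h

lemma contDiff_besselSeries (hm : 0 < m) : ContDiff ℝ ∞ (besselSeries m) := by
  rw [contDiff_infty]
  intro N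
  induction N generalizing m with
  | zero =>
    exact contDiff_zero.2 (continuous_iff_continuousAt.2 fun s =>
      (hasDerivAt_besselSeries hm s).continuousAt)
  | succ N ih =>
    rw [Nat.cast_add, Nat.cast_one, contDiff_succ_iff_deriv]
    refine ⟨fun s => (hasDerivAt_besselSeries hm s).differentiableAt, by simp, ?_⟩
    rw [funext fun s => (hasDerivAt_besselSeries hm s).deriv]
    exact (ih (by positivity)).div_const _

lemma besselSeries_eq_besselSeries_add_two (hm : 0 < m) (s : ℝ) :
    besselSeries m s = besselSeries (m + 2) s + s * besselSeries (m + 4) s / (m * (m + 2)) := by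
  have e : ∀ k, besselCoeff m (k + 1) * s ^ (k + 1) = besselCoeff (m + 2) (k + 1) * s ^ (k + 1)
      + s * (besselCoeff (m + 4) k * s ^ k) / (m * (m + 2)) := fun k => by
    have e1 := succ_mul_besselCoeff_succ (m := m + 2) (by positivity) k
    have e2 := besselCoeff_add_two_mul hm (k + 1)
    push_cast at e2
    rw [show m + 2 + 2 = m + 4 by ring, eq_div_iff (by positivity)] at e1
    rw [pow_succ]
    field_simp
    linear_combination (s * s ^ k) * e1 - (s * s ^ k * (m + 2)) * e2
  have h0 := summable_besselCoeff_mul_pow hm s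
  have h2 := summable_besselCoeff_mul_pow (m := m + 2) (by positivity) s
  have h4 := summable_besselCoeff_mul_pow (m := m + 4) (by positivity) s
  unfold besselSeries
  rw [h0.tsum_eq_zero_add, h2.tsum_eq_zero_add, tsum_congr e, besselCoeff_zero,
    besselCoeff_zero, ((summable_nat_add_iff 1).2 h2).tsum_add ((h4.mul_left s).div_const _),
    tsum_div_const, tsum_mul_left, add_assoc]

lemma besselSeries_ode (hm : 0 < m) (s : ℝ) :
    4 * s * (besselSeries (m + 4) s / (2 * (m + 2)) / (2 * m))
      + 2 * m * (besselSeries (m + 2) s / (2 * m)) = besselSeries m s := by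
  rw [besselSeries_eq_besselSeries_add_two hm]
  field_simp
  ring

lemma one_le_besselSeries (hm : 0 < m) {s : ℝ} (hs : 0 ≤ s) : 1 ≤ besselSeries m s := by
  have h := (summable_besselCoeff_mul_pow hm s).le_tsum 0 fun k _ =>
    mul_nonneg (besselCoeff_nonneg hm k) (pow_nonneg hs k)
  rwa [besselCoeff_zero, pow_zero, mul_one] at h

lemma besselCoeff_sq_mul_factorial_le (d k : ℕ) :
    besselCoeff (d + 1) k ^ 2 * ((2 * k).factorial * (2 * k + d).factorial : ℝ)
      ≤ d.factorial := by
  induction k with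
  | zero => simp
  | succ k ih =>
    have ratio : ((2 * k + 1) * (2 * k + d + 2) : ℝ) / ((2 * k + 2) * (2 * k + d + 1)) ≤ 1 := by
      rw [div_le_one (by positivity)]
      linarith [(d.cast_nonneg : (0 : ℝ) ≤ d)]
    calc besselCoeff (d + 1) (k + 1) ^ 2
          * ((2 * (k + 1)).factorial * (2 * (k + 1) + d).factorial : ℝ)
        = besselCoeff (d + 1) k ^ 2 * ((2 * k).factorial * (2 * k + d).factorial)
          * (((2 * k + 1) * (2 * k + d + 2)) / ((2 * k + 2) * (2 * k + d + 1))) := by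
          rw [besselCoeff_succ, ← add_assoc, show 2 * (k + 1) + d = 2 * k + d + 1 + 1 by ring,
            show 2 * (k + 1) = 2 * k + 1 + 1 by ring]
          simp only [Nat.factorial_succ]
          push_cast
          field_simp
          ring
      _ ≤ (d.factorial : ℝ) * 1 := by gcongr
      _ = (d.factorial : ℝ) := mul_one _

lemma besselCoeff_le_inv_factorial (d k : ℕ) :
    besselCoeff (d + 1) k ≤ ((2 * k).factorial : ℝ)⁻¹ := by
  have hd : (0 : ℝ) < d.factorial := by positivity
  have hfac : ((2 * k).factorial * d.factorial : ℝ) ≤ (2 * k + d).factorial := by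
    exact_mod_cast Nat.le_of_dvd (Nat.factorial_pos _)
      (Nat.factorial_mul_factorial_dvd_factorial_add _ _)
  have hsq : (besselCoeff (d + 1) k * (2 * k).factorial) ^ 2 ≤ 1 :=
    le_of_mul_le_mul_right (calc
      (besselCoeff (d + 1) k * (2 * k).factorial) ^ 2 * d.factorial
        = besselCoeff (d + 1) k ^ 2 * ((2 * k).factorial * ((2 * k).factorial * d.factorial)) := by
          ring
      _ ≤ besselCoeff (d + 1) k ^ 2 * ((2 * k).factorial * (2 * k + d).factorial) := by gcongr
      _ ≤ 1 * d.factorial := by rw [one_mul]; exact besselCoeff_sq_mul_factorial_le d k) hd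
  rw [← one_div, le_div_iff₀ (by positivity)]
  exact le_of_abs_le ((sq_le_one_iff_abs_le_one _).1 hsq)

lemma besselSeries_sq_le_exp (d : ℕ) {r : ℝ} (hr : 0 ≤ r) :
    besselSeries (d + 1) (r ^ 2) ≤ Real.exp r :=
  calc besselSeries (d + 1) (r ^ 2)
      ≤ ∑' k : ℕ, r ^ (2 * k + 0) / (2 * k + 0).factorial :=
        (summable_besselCoeff_mul_pow (by positivity) _).tsum_le_tsum
          (fun k => by
            rw [← pow_mul, add_zero, div_eq_inv_mul]
            gcongr
            exact besselCoeff_le_inv_factorial d k)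
          (summable_pow_div_factorial_two_mul_add r 0)
    _ ≤ Real.exp r := tsum_pow_div_factorial_two_mul_add_le_exp hr 0

lemma sq_besselSeries_sq_mul_pow_le (d : ℕ) {r : ℝ} (hr : 0 ≤ r) :
    besselSeries (d + 1) (r ^ 2) ^ 2 * r ^ d ≤ d.factorial * Real.exp (2 * r) := by
  set A : ℕ → ℝ := fun k => r ^ (2 * k + 0) / (2 * k + 0).factorial
  set B : ℕ → ℝ := fun k => r ^ (2 * k + d) / (2 * k + d).factorial
  have hA : Summable A := summable_pow_div_factorial_two_mul_add r 0
  have hB : Summable B := summable_pow_div_factorial_two_mul_add r d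
  have hr_d : √(r ^ d) ^ 2 = r ^ d := Real.sq_sqrt (by positivity)
  have term_le (k : ℕ) : (besselCoeff (d + 1) k * (r ^ 2) ^ k * √(r ^ d)) ^ 2
      ≤ A k * (d.factorial * B k) := by
    have h := besselCoeff_sq_mul_factorial_le d k
    rw [← le_div_iff₀ (by positivity)] at h
    calc (besselCoeff (d + 1) k * (r ^ 2) ^ k * √(r ^ d)) ^ 2
        = besselCoeff (d + 1) k ^ 2 * (r ^ (2 * k) * r ^ (2 * k + d)) := by
          rw [mul_pow, hr_d]
          ring
      _ ≤ d.factorial / ((2 * k).factorial * (2 * k + d).factorial)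
          * (r ^ (2 * k) * r ^ (2 * k + d)) := by gcongr
      _ = A k * (d.factorial * B k) := by
          simp only [A, B, add_zero]
          field_simp
  calc besselSeries (d + 1) (r ^ 2) ^ 2 * r ^ d
      = (∑' k, besselCoeff (d + 1) k * (r ^ 2) ^ k * √(r ^ d)) ^ 2 := by
        rw [tsum_mul_right, mul_pow, hr_d, besselSeries]
    _ ≤ (∑' k, A k) * ∑' k, d.factorial * B k :=
        sq_tsum_le_tsum_mul_tsum
          ((summable_besselCoeff_mul_pow (by positivity) _).mul_right _) hA (hB.mul_left _)
          (fun k => by positivity) (fun k => by positivity) term_le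
    _ = d.factorial * ((∑' k, A k) * ∑' k, B k) := by rw [tsum_mul_left]; ring
    _ ≤ d.factorial * (Real.exp r * Real.exp r) := by
        gcongr
        · exact tsum_pow_div_factorial_two_mul_add_le_exp hr 0
        · exact tsum_pow_div_factorial_two_mul_add_le_exp hr d
    _ = d.factorial * Real.exp (2 * r) := by rw [← Real.exp_add, two_mul]

end Bessel

section NormSq

variable {E F : Type*} [NormedAddCommGroup E]

lemma laplacian_comp_norm_sq [InnerProductSpace ℝ E] [FiniteDimensional ℝ E]
    {h h' h'' : ℝ → ℝ} (hh : ∀ s, HasDerivAt h (h' s) s) (hh' : ∀ s, HasDerivAt h' (h'' s) s)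
    (x : E) :
    Laplacian.laplacian (fun y : E => h (‖y‖ ^ 2)) x
      = 4 * ‖x‖ ^ 2 * h'' (‖x‖ ^ 2) + 2 * Module.finrank ℝ E * h' (‖x‖ ^ 2) := by
  obtain ⟨L, hL⟩ : ∃ L : E →L[ℝ] E →L[ℝ] ℝ, ∀ y, L y = innerSL ℝ y := ⟨innerSL ℝ, fun _ => rfl⟩
  have hasFDerivAt_comp {k k' : ℝ → ℝ} (hk : ∀ s, HasDerivAt k (k' s) s) (y : E) :
      HasFDerivAt (fun y : E => k (‖y‖ ^ 2)) ((2 * k' (‖y‖ ^ 2)) • L y) y := by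
    refine ((hk _).comp_hasFDerivAt y (hasStrictFDerivAt_norm_sq y).hasFDerivAt).congr_fderiv ?_
    rw [hL, smul_comm, ← smul_assoc, nsmul_eq_mul, Nat.cast_ofNat]
  have fderiv_comp : fderiv ℝ (fun y : E => h (‖y‖ ^ 2)) = fun y => (2 * h' (‖y‖ ^ 2)) • L y :=
    funext fun y => (hasFDerivAt_comp hh y).fderiv
  have second := ((hasFDerivAt_comp hh' x).const_mul 2).fun_smul L.hasFDerivAt
  let b := stdOrthonormalBasis ℝ E
  have term (i) : iteratedFDeriv ℝ 2 (fun y : E => h (‖y‖ ^ 2)) x ![b i, b i]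
      = 4 * h'' (‖x‖ ^ 2) * inner ℝ (b i) x ^ 2 + 2 * h' (‖x‖ ^ 2) := by
    rw [iteratedFDeriv_two_apply, fderiv_comp, second.fderiv]
    simp [hL, innerSL_apply_apply, real_inner_comm x]
    ring
  rw [InnerProductSpace.laplacian_eq_iteratedFDeriv_orthonormalBasis _ b]
  simp only [term, Finset.sum_add_distrib, ← Finset.mul_sum, b.sum_sq_inner_right,
    Finset.sum_const, Finset.card_univ, Fintype.card_fin, nsmul_eq_mul]
  ring

lemma setIntegral_closedBall_fun_norm [NormedSpace ℝ E] [FiniteDimensional ℝ E] [Nontrivial E]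
    [MeasurableSpace E] [BorelSpace E] [NormedAddCommGroup F] [NormedSpace ℝ F]
    (μ : Measure E) [μ.IsAddHaarMeasure] (f : ℝ → F) {b : ℝ} (hb : 0 ≤ b) :
    ∫ x in Metric.closedBall (0 : E) b, f ‖x‖ ∂μ
      = Module.finrank ℝ E • μ.real (Metric.ball 0 1)
        • ∫ r in (0 : ℝ)..b, r ^ (Module.finrank ℝ E - 1) • f r := by
  have indicator_norm (x : E) :
      (Metric.closedBall (0 : E) b).indicator (fun x => f ‖x‖) x = (Iic b).indicator f ‖x‖ := by
    simp [indicator]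
  rw [← integral_indicator Metric.isClosed_closedBall.measurableSet,
    integral_congr_ae (.of_forall indicator_norm), integral_fun_norm_addHaar μ,
    intervalIntegral.integral_of_le hb, ← Ioi_inter_Iic, ← setIntegral_indicator measurableSet_Iic]
  simp only [indicator_smul]

end NormSq

section Radial

variable {n : ℕ}

/-- The radial solution of `Δφ = φ` on `ℝⁿ` with `φ 0 = 1`. It is the spatial factor of the test
function `e^{-t} φ`, which solves the linear wave equation. -/
def radialEigenfunction (n : ℕ) (x : Space n) : ℝ := besselSeries n (‖x‖ ^ 2)

lemma contDiff_radialEigenfunction (hn : 1 ≤ n) : ContDiff ℝ ∞ (radialEigenfunction n) :=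
  (contDiff_besselSeries (by positivity)).comp (contDiff_norm_sq ℝ)

lemma laplacian_radialEigenfunction (hn : 1 ≤ n) (x : Space n) :
    Laplacian.laplacian (radialEigenfunction n) x = radialEigenfunction n x := by
  have hn' : (0 : ℝ) < n := by positivity
  have second (s : ℝ) : HasDerivAt (fun s => besselSeries (n + 2) s / (2 * n))
      (besselSeries (n + 4) s / (2 * (n + 2)) / (2 * n)) s := by
    have h := (hasDerivAt_besselSeries (m := n + 2) (by positivity) s).div_const (2 * (n : ℝ))
    rwa [show (n : ℝ) + 2 + 2 = n + 4 by ring] at h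
  have h := laplacian_comp_norm_sq (hasDerivAt_besselSeries hn') second x
  rw [finrank_euclideanSpace_fin, besselSeries_ode hn'] at h
  exact h

lemma one_le_radialEigenfunction (hn : 1 ≤ n) (x : Space n) : 1 ≤ radialEigenfunction n x :=
  one_le_besselSeries (by positivity) (by positivity)

lemma exists_sq_radialEigenfunction_mul_le (hn : 1 ≤ n) :
    ∃ K : ℝ, 0 < K ∧ ∀ x : Space n,
      radialEigenfunction n x ^ 2 * (1 + ‖x‖) ^ (n - 1) ≤ K * Real.exp (2 * ‖x‖) := by
  obtain ⟨d, rfl⟩ := Nat.exists_eq_add_of_le' hn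
  refine ⟨2 ^ (d - 1) * (1 + d.factorial), by positivity, fun x => ?_⟩
  have hx := norm_nonneg x
  have small : besselSeries (d + 1) (‖x‖ ^ 2) ^ 2 ≤ Real.exp (2 * ‖x‖) := by
    rw [two_mul, Real.exp_add, ← sq]
    have := one_le_besselSeries (m := d + 1) (by positivity) (sq_nonneg ‖x‖)
    gcongr
    exact besselSeries_sq_le_exp d hx
  rw [Nat.add_sub_cancel, radialEigenfunction, Nat.cast_add, Nat.cast_one]
  calc besselSeries (d + 1) (‖x‖ ^ 2) ^ 2 * (1 + ‖x‖) ^ d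
      ≤ besselSeries (d + 1) (‖x‖ ^ 2) ^ 2 * (2 ^ (d - 1) * (1 ^ d + ‖x‖ ^ d)) := by
        gcongr
        exact add_pow_le zero_le_one hx d
    _ = 2 ^ (d - 1) * (besselSeries (d + 1) (‖x‖ ^ 2) ^ 2
          + besselSeries (d + 1) (‖x‖ ^ 2) ^ 2 * ‖x‖ ^ d) := by rw [one_pow]; ring
    _ ≤ 2 ^ (d - 1) * (Real.exp (2 * ‖x‖) + d.factorial * Real.exp (2 * ‖x‖)) := by
        gcongr ?_ * (?_ + ?_)
        exact sq_besselSeries_sq_mul_pow_le d hx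
    _ = 2 ^ (d - 1) * (1 + d.factorial) * Real.exp (2 * ‖x‖) := by ring

lemma one_add_pow_le_factorial_mul_exp {s : ℝ} (hs : 0 ≤ s) (d : ℕ) :
    (1 + s) ^ d ≤ d.factorial * Real.exp (1 + s) := by
  have h := Real.pow_div_factorial_le_exp (1 + s) (by positivity) d
  rwa [div_le_iff₀' (by positivity)] at h

/-- Inside the light cone, `e^{-t} φ` is concentrated near the boundary. -/
lemma exists_sq_radialEigenfunction_mul_exp_le (hn : 1 ≤ n) {R : ℝ} (hR : 0 ≤ R) :
    ∃ K : ℝ, 0 < K ∧ ∀ t : ℝ, 0 ≤ t → ∀ x : Space n, ‖x‖ ≤ t + R →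
      (radialEigenfunction n x * Real.exp (-t)) ^ 2 * (1 + t) ^ (n - 1)
        ≤ K * Real.exp (‖x‖ - t) := by
  obtain ⟨K, hK, hKφ⟩ := exists_sq_radialEigenfunction_mul_le hn
  set d := n - 1
  refine ⟨K * d.factorial * Real.exp (1 + R), by positivity, fun t ht x hx => ?_⟩
  set s := t + R - ‖x‖
  have hs : 0 ≤ s := sub_nonneg.2 hx
  have hx0 := norm_nonneg x
  have weight : (1 + t) ^ d ≤ (1 + ‖x‖) ^ d * (1 + s) ^ d := by
    rw [← mul_pow]
    gcongr
    nlinarith [mul_nonneg hx0 hs]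
  calc (radialEigenfunction n x * Real.exp (-t)) ^ 2 * (1 + t) ^ d
      ≤ (radialEigenfunction n x * Real.exp (-t)) ^ 2 * ((1 + ‖x‖) ^ d * (1 + s) ^ d) := by
        gcongr
    _ = radialEigenfunction n x ^ 2 * (1 + ‖x‖) ^ d * (Real.exp (-t) ^ 2 * (1 + s) ^ d) := by
        ring
    _ ≤ K * Real.exp (2 * ‖x‖) * (Real.exp (-t) ^ 2 * (d.factorial * Real.exp (1 + s))) := by
        gcongr ?_ * (_ * ?_)
        · exact hKφ x
        · exact one_add_pow_le_factorial_mul_exp hs d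
    _ = K * d.factorial * (Real.exp (2 * ‖x‖) * Real.exp (-t) ^ 2 * Real.exp (1 + s)) := by ring
    _ = K * d.factorial * (Real.exp (1 + R) * Real.exp (‖x‖ - t)) := by
        rw [sq, ← Real.exp_add, ← Real.exp_add, ← Real.exp_add, ← Real.exp_add]
        congr 2
        ring
    _ = K * d.factorial * Real.exp (1 + R) * Real.exp (‖x‖ - t) := by ring

lemma exists_radialEigenfunction_mul_exp_rpow_le (hn : 1 ≤ n) {q R : ℝ} (hq : 0 < q)
    (hR : 0 ≤ R) :
    ∃ K : ℝ, 0 < K ∧ ∀ t : ℝ, 0 ≤ t → ∀ x : Space n, ‖x‖ ≤ t + R →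
      (radialEigenfunction n x * Real.exp (-t)) ^ q
        ≤ K * (1 + t) ^ (-(((n : ℝ) - 1) * (q / 2))) * Real.exp (q / 2 * (‖x‖ - t)) := by
  obtain ⟨K, hK, hKφ⟩ := exists_sq_radialEigenfunction_mul_exp_le hn hR
  refine ⟨K ^ (q / 2), by positivity, fun t ht x hx => ?_⟩
  have ht1 : 0 < 1 + t := by positivity
  have hφ : 0 ≤ radialEigenfunction n x * Real.exp (-t) := by
    have := one_le_radialEigenfunction hn x
    positivity
  have hsq : (radialEigenfunction n x * Real.exp (-t)) ^ 2
      ≤ K * Real.exp (‖x‖ - t) * (1 + t) ^ (-((n : ℝ) - 1)) := by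
    rw [Real.rpow_neg ht1.le, ← Nat.cast_pred hn, Real.rpow_natCast, ← div_eq_mul_inv,
      le_div_iff₀ (by positivity)]
    exact hKφ t ht x hx
  calc (radialEigenfunction n x * Real.exp (-t)) ^ q
      = ((radialEigenfunction n x * Real.exp (-t)) ^ 2) ^ (q / 2) := by
        rw [← Real.rpow_natCast, ← Real.rpow_mul hφ, Nat.cast_ofNat, mul_div_cancel₀ _ two_ne_zero]
    _ ≤ (K * Real.exp (‖x‖ - t) * (1 + t) ^ (-((n : ℝ) - 1))) ^ (q / 2) := by gcongr
    _ = K ^ (q / 2) * (1 + t) ^ (-(((n : ℝ) - 1) * (q / 2))) * Real.exp (q / 2 * (‖x‖ - t)) := by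
        rw [Real.mul_rpow (by positivity) (by positivity), Real.mul_rpow hK.le (by positivity),
          ← Real.exp_mul, ← Real.rpow_mul ht1.le, mul_comm (‖x‖ - t), neg_mul]
        ring

lemma integral_exp_mul_sub_le {c : ℝ} (hc : 0 < c) (a b t : ℝ) :
    ∫ r in a..b, Real.exp (c * (r - t)) ≤ Real.exp (c * (b - t)) / c := by
  rw [intervalIntegral.integral_eq_sub_of_hasDerivAt (f := fun r => Real.exp (c * (r - t)) / c)
    (fun r _ => ((((hasDerivAt_id r).sub_const t).const_mul c).exp.div_const c).congr_deriv
      (by simp [hc.ne'])) (Continuous.intervalIntegrable (by fun_prop) _ _)]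
  exact sub_le_self _ (by positivity)

lemma exists_integral_closedBall_exp_le (hn : 1 ≤ n) {c R : ℝ} (hc : 0 < c) (hR : 0 ≤ R) :
    ∃ C : ℝ, 0 < C ∧ ∀ t : ℝ, 0 ≤ t →
      ∫ x in Metric.closedBall (0 : Space n) (t + R), Real.exp (c * (‖x‖ - t))
        ≤ C * (1 + t) ^ (n - 1) := by
  have : Nonempty (Fin n) := ⟨⟨0, hn⟩⟩
  set V : ℝ := (volume : Measure (Space n)).real (Metric.ball 0 1)
  have hV : 0 < V := ENNReal.toReal_pos (Metric.measure_ball_pos volume 0 one_pos).ne'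
    measure_ball_lt_top.ne
  refine ⟨n * V * ((1 + R) ^ (n - 1) * (Real.exp (c * R) / c)), by positivity, fun t ht => ?_⟩
  have hb : 0 ≤ t + R := by positivity
  have radial : ∫ r in (0 : ℝ)..(t + R), r ^ (n - 1) * Real.exp (c * (r - t))
      ≤ (t + R) ^ (n - 1) * (Real.exp (c * R) / c) := calc
    _ ≤ ∫ r in (0 : ℝ)..(t + R), (t + R) ^ (n - 1) * Real.exp (c * (r - t)) := by
        refine intervalIntegral.integral_mono_on hb
          (Continuous.intervalIntegrable (by fun_prop) _ _)
          (Continuous.intervalIntegrable (by fun_prop) _ _) fun r hr => ?_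
        have := hr.1
        have := hr.2
        gcongr
    _ ≤ (t + R) ^ (n - 1) * (Real.exp (c * R) / c) := by
        rw [intervalIntegral.integral_const_mul]
        gcongr
        simpa using integral_exp_mul_sub_le hc 0 (t + R) t
  rw [setIntegral_closedBall_fun_norm volume (fun r => Real.exp (c * (r - t))) hb,
    finrank_euclideanSpace_fin, nsmul_eq_mul, smul_eq_mul, ← mul_assoc]
  calc n * V * ∫ r in (0 : ℝ)..(t + R), r ^ (n - 1) * Real.exp (c * (r - t))
      ≤ n * V * (((1 + R) * (1 + t)) ^ (n - 1) * (Real.exp (c * R) / c)) := by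
        gcongr
        refine radial.trans ?_
        gcongr
        nlinarith
    _ = n * V * ((1 + R) ^ (n - 1) * (Real.exp (c * R) / c)) * (1 + t) ^ (n - 1) := by
        rw [mul_pow]
        ring

lemma exists_integral_radialEigenfunction_mul_exp_rpow_le (hn : 1 ≤ n) {q R : ℝ} (hq : 0 < q)
    (hR : 0 ≤ R) :
    ∃ C : ℝ, 0 < C ∧ ∀ t : ℝ, 0 ≤ t →
      ∫ x in Metric.closedBall (0 : Space n) (t + R),
          (radialEigenfunction n x * Real.exp (-t)) ^ q
        ≤ C * (1 + t) ^ (((n : ℝ) - 1) * (1 - q / 2)) := by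
  obtain ⟨K, hK, hKφ⟩ := exists_radialEigenfunction_mul_exp_rpow_le hn hq hR
  obtain ⟨C, hC, hCexp⟩ := exists_integral_closedBall_exp_le hn (half_pos hq) hR
  refine ⟨K * C, by positivity, fun t ht => ?_⟩
  have ht1 : 0 < 1 + t := by positivity
  have hφ : Continuous (radialEigenfunction n) := (contDiff_radialEigenfunction hn).continuous
  calc ∫ x in Metric.closedBall (0 : Space n) (t + R),
        (radialEigenfunction n x * Real.exp (-t)) ^ q
      ≤ ∫ x in Metric.closedBall (0 : Space n) (t + R),
        K * (1 + t) ^ (-(((n : ℝ) - 1) * (q / 2))) * Real.exp (q / 2 * (‖x‖ - t)) :=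
        setIntegral_mono_on
          (((hφ.mul_const _).rpow_const fun x => Or.inr hq.le).continuousOn.integrableOn_compact
            (isCompact_closedBall _ _))
          (ContinuousOn.integrableOn_compact (isCompact_closedBall _ _) (by fun_prop))
          Metric.isClosed_closedBall.measurableSet
          fun x hx => hKφ t ht x (mem_closedBall_zero_iff.1 hx)
    _ ≤ K * (1 + t) ^ (-(((n : ℝ) - 1) * (q / 2))) * (C * (1 + t) ^ ((n : ℝ) - 1)) := by
        rw [integral_const_mul, ← Nat.cast_pred hn, Real.rpow_natCast]
        gcongr
        exact hCexp t ht
    _ = K * C * ((1 + t) ^ (-(((n : ℝ) - 1) * (q / 2))) * (1 + t) ^ ((n : ℝ) - 1)) := by ring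
    _ = K * C * (1 + t) ^ (((n : ℝ) - 1) * (1 - q / 2)) := by
        rw [← Real.rpow_add ht1]
        ring_nf

end Radial

section DuBoisReymond

variable {a b : ℝ}

lemma exists_contDiff_deriv_eq_of_integral_eq_zero {φ : ℝ → ℝ} (hφ : ContDiff ℝ ∞ φ)
    (hs : tsupport φ ⊆ Ioo a b) (h0 : ∫ t in a..b, φ t = 0) :
    ∃ ξ : ℝ → ℝ, ContDiff ℝ ∞ ξ ∧ HasCompactSupport ξ ∧ tsupport ξ ⊆ Ioo a b ∧ deriv ξ = φ := by
  obtain hempty | hne := (tsupport φ).eq_empty_or_nonempty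
  · obtain rfl := tsupport_eq_empty_iff.1 hempty
    exact ⟨0, contDiff_const, HasCompactSupport.zero, hs, deriv_zero⟩
  have hcompact : IsCompact (tsupport φ) :=
    isCompact_Icc.of_isClosed_subset (isClosed_tsupport φ) (hs.trans Ioo_subset_Icc_self)
  obtain ⟨c, hc, hcmin⟩ := hcompact.exists_isLeast hne
  obtain ⟨d, hd, hdmax⟩ := hcompact.exists_isGreatest hne
  have hφ0 {t : ℝ} (ht : t ∉ Icc c d) : φ t = 0 :=
    image_eq_zero_of_notMem_tsupport fun h => ht ⟨hcmin h, hdmax h⟩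
  have hint (r s : ℝ) : IntervalIntegrable φ volume r s := hφ.continuous.intervalIntegrable r s
  have hderiv : deriv (fun t => ∫ s in a..t, φ s) = φ :=
    funext fun t => hφ.continuous.deriv_integral φ a t
  have hsupp : Function.support (fun t => ∫ s in a..t, φ s) ⊆ Icc c d := by
    refine Function.support_subset_iff'.2 fun t ht => ?_
    obtain htc | hdt : t < c ∨ d < t := by
      by_contra! h
      exact ht h
    · refine intervalIntegral.integral_zero_ae (Filter.Eventually.of_forall fun s hs' => hφ0 ?_)
      exact fun h => (h.1.trans hs'.2).not_gt (max_lt (hs hc).1 htc)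
    · rw [← intervalIntegral.integral_add_adjacent_intervals (hint a b) (hint b t), h0, zero_add]
      refine intervalIntegral.integral_zero_ae (Filter.Eventually.of_forall fun s hs' => hφ0 ?_)
      exact fun h => (hs'.1.trans_le h.2).not_gt (lt_min (hs hd).2 hdt)
  refine ⟨_, contDiff_infty_iff_deriv.2 ⟨fun t => ?_, by rwa [hderiv]⟩,
    .of_support_subset_isCompact isCompact_Icc hsupp,
    (closure_minimal hsupp isClosed_Icc).trans (Icc_subset_Ioo (hs hc).1 (hs hd).2), hderiv⟩
  exact (hφ.continuous.integral_hasStrictDerivAt a t).hasDerivAt.differentiableAt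

lemma exists_contDiff_integral_eq_one (hab : a < b) :
    ∃ ρ : ℝ → ℝ, ContDiff ℝ ∞ ρ ∧ tsupport ρ ⊆ Ioo a b ∧ ∫ t in a..b, ρ t = 1 := by
  let bump : ContDiffBump ((a + b) / 2) := ⟨(b - a) / 8, (b - a) / 4, by linarith, by linarith⟩
  have hsupp : tsupport (bump.normed volume) ⊆ Ioo a b := by
    rw [bump.tsupport_normed_eq, Real.closedBall_eq_Icc]
    exact Icc_subset_Ioo (by simp only [bump]; linarith) (by simp only [bump]; linarith)
  refine ⟨bump.normed volume, bump.contDiff_normed, hsupp, ?_⟩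
  rw [intervalIntegral.integral_eq_integral_of_support_subset
    ((subset_tsupport _).trans (hsupp.trans Ioo_subset_Ioc_self)), bump.integral_normed]

lemma integral_mul_eq_of_integral_mul_deriv_eq_zero {Z ρ : ℝ → ℝ}
    (hZ : ContinuousOn Z (uIcc a b))
    (h : ∀ ξ : ℝ → ℝ, ContDiff ℝ ∞ ξ → HasCompactSupport ξ → tsupport ξ ⊆ Ioo a b →
      ∫ t in a..b, Z t * deriv ξ t = 0)
    (hρ : ContDiff ℝ ∞ ρ) (hρs : tsupport ρ ⊆ Ioo a b) (hρ1 : ∫ t in a..b, ρ t = 1)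
    {φ : ℝ → ℝ} (hφ : ContDiff ℝ ∞ φ) (hφs : tsupport φ ⊆ Ioo a b) :
    ∫ t in a..b, Z t * φ t = (∫ t in a..b, φ t) * ∫ t in a..b, Z t * ρ t := by
  have hZint {χ : ℝ → ℝ} (hχ : Continuous χ) : IntervalIntegrable (fun t => Z t * χ t) volume a b :=
    (hZ.mul hχ.continuousOn).intervalIntegrable
  set m := ∫ t in a..b, φ t
  have hρm : Continuous fun t => m * ρ t := continuous_const.mul hρ.continuous
  obtain ⟨ξ, hξ, hξc, hξs, hξd⟩ := exists_contDiff_deriv_eq_of_integral_eq_zero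
    (a := a) (b := b) (φ := fun t => φ t - m * ρ t) (hφ.sub (contDiff_const.mul hρ))
    ((tsupport_sub _ _).trans (union_subset hφs (tsupport_mul_subset_right.trans hρs))) (by
      rw [intervalIntegral.integral_sub (hφ.continuous.intervalIntegrable _ _)
        (hρm.intervalIntegrable _ _), intervalIntegral.integral_const_mul, hρ1, mul_one, sub_self])
  have hzero := h ξ hξ hξc hξs
  simp only [hξd, mul_sub] at hzero
  rw [intervalIntegral.integral_sub (hZint hφ.continuous) (hZint hρm), sub_eq_zero] at hzero
  rw [hzero, ← intervalIntegral.integral_const_mul]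
  simp only [mul_left_comm m]

lemma eqOn_const_of_integral_mul_deriv_eq_zero (hab : a < b) {Z : ℝ → ℝ}
    (hZ : ContinuousOn Z (Icc a b))
    (h : ∀ ξ : ℝ → ℝ, ContDiff ℝ ∞ ξ → HasCompactSupport ξ → tsupport ξ ⊆ Ioo a b →
      ∫ t in a..b, Z t * deriv ξ t = 0) :
    EqOn Z (fun _ => Z a) (Icc a b) := by
  obtain ⟨ρ, hρ, hρs, hρ1⟩ := exists_contDiff_integral_eq_one hab
  set c := ∫ t in a..b, Z t * ρ t
  have hconst : EqOn Z (fun _ => c) (Icc a b) := by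
    have hae : ∀ᵐ t, t ∈ Ioo a b → Z t - c = 0 := by
      refine isOpen_Ioo.ae_eq_zero_of_integral_contDiff_smul_eq_zero
        (((hZ.sub continuousOn_const).mono Ioo_subset_Icc_self).locallyIntegrableOn
          measurableSet_Ioo) fun φ hφ _ hφs => ?_
      have hφs' : Function.support φ ⊆ Ioc a b :=
        (subset_tsupport φ).trans (hφs.trans Ioo_subset_Ioc_self)
      have hφZ : IntervalIntegrable (fun t => φ t * Z t) volume a b := by
        simpa only [mul_comm] using
          (hZ.fun_mul hφ.continuous.continuousOn).intervalIntegrable_of_Icc hab.le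
      simp only [smul_eq_mul, mul_sub]
      rw [← intervalIntegral.integral_eq_integral_of_support_subset (a := a) (b := b)
          fun t ht => hφs' fun hφt => ht (by simp only [hφt, zero_mul, sub_self]),
        intervalIntegral.integral_sub hφZ ((hφ.continuous.intervalIntegrable a b).mul_const c),
        intervalIntegral.integral_mul_const, sub_eq_zero,
        ← integral_mul_eq_of_integral_mul_deriv_eq_zero (uIcc_of_le hab.le ▸ hZ) h hρ hρs hρ1 hφ
          hφs]
      exact intervalIntegral.integral_congr fun t _ => mul_comm _ _
    refine Measure.eqOn_Icc_of_ae_eq volume hab.ne ?_ hZ continuousOn_const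
    rw [← restrict_Ioo_eq_restrict_Icc, Filter.EventuallyEq, ae_restrict_iff' measurableSet_Ioo]
    filter_upwards [hae] with t ht htm using sub_eq_zero.1 (ht htm)
  exact fun t ht => (hconst ht).trans (hconst (left_mem_Icc.2 hab.le)).symm

lemma integral_primitive_mul_deriv {K θ : ℝ → ℝ} (hK : IntervalIntegrable K volume a b)
    (hθ : ContDiffOn ℝ 1 θ (uIcc a b)) :
    ∫ t in a..b, (∫ s in a..t, K s) * deriv θ t
      = (∫ t in a..b, K t) * θ b - ∫ t in a..b, K t * θ t := by
  rw [(hK.absolutelyContinuousOnInterval_intervalIntegral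
    left_mem_uIcc).integral_mul_deriv_eq_deriv_mul hθ.absolutelyContinuousOnInterval,
    intervalIntegral.integral_same, zero_mul, sub_zero]
  congr 1
  refine intervalIntegral.integral_congr_ae ?_
  filter_upwards [hK.ae_hasDerivAt_integral] with t ht htm
  rw [(ht (uIoc_subset_uIcc htm) a left_mem_uIcc).deriv]

lemma eq_add_integral_of_integral_mul_deriv_eq (hab : a < b) {W K : ℝ → ℝ}
    (hW : ContinuousOn W (Icc a b)) (hK : IntervalIntegrable K volume a b)
    (h : ∀ ξ : ℝ → ℝ, ContDiff ℝ ∞ ξ → HasCompactSupport ξ → tsupport ξ ⊆ Ioo a b →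
      ∫ t in a..b, W t * deriv ξ t = -∫ t in a..b, K t * ξ t) {t : ℝ} (ht : t ∈ Icc a b) :
    W t = W a + ∫ s in a..t, K s := by
  have hprim : ContinuousOn (fun t => ∫ s in a..t, K s) (Icc a b) := by
    have := (hK.absolutelyContinuousOnInterval_intervalIntegral left_mem_uIcc).continuousOn
    rwa [uIcc_of_le hab.le] at this
  have hZ := eqOn_const_of_integral_mul_deriv_eq_zero hab (hW.sub hprim) fun ξ hξ hξc hξs => ?_
  · have := hZ ht
    simp only [Pi.sub_apply, intervalIntegral.integral_same, sub_zero] at this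
    linarith
  · have hξd : ContinuousOn (deriv ξ) (Icc a b) := (hξ.continuous_deriv (by simp)).continuousOn
    have hξb : ξ b = 0 := image_eq_zero_of_notMem_tsupport fun hb => (hξs hb).2.false
    simp only [Pi.sub_apply, sub_mul]
    rw [intervalIntegral.integral_sub ((hW.fun_mul hξd).intervalIntegrable_of_Icc hab.le)
      ((hprim.fun_mul hξd).intervalIntegrable_of_Icc hab.le), h ξ hξ hξc hξs,
      integral_primitive_mul_deriv hK (hξ.of_le (by simp)).contDiffOn, hξb]
    ring

lemma integral_mul_deriv_of_eq_add_integral {W K θ : ℝ → ℝ} (hK : IntervalIntegrable K volume a b)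
    (hW : ∀ t ∈ uIcc a b, W t = W a + ∫ s in a..t, K s) (hθ : ContDiff ℝ 1 θ) :
    ∫ t in a..b, W t * deriv θ t = W b * θ b - W a * θ a - ∫ t in a..b, K t * θ t := by
  have hprim := (hK.absolutelyContinuousOnInterval_intervalIntegral left_mem_uIcc).continuousOn
  have hθd := hθ.continuous_deriv le_rfl
  calc ∫ t in a..b, W t * deriv θ t
      = ∫ t in a..b, (W a * deriv θ t + (∫ s in a..t, K s) * deriv θ t) :=
        intervalIntegral.integral_congr fun t ht => by rw [hW t ht, add_mul]
    _ = W a * (θ b - θ a) + ((∫ t in a..b, K t) * θ b - ∫ t in a..b, K t * θ t) := by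
        rw [intervalIntegral.integral_add
          ((hθd.intervalIntegrable a b).const_mul (W a))
          (hprim.fun_mul hθd.continuousOn).intervalIntegrable,
          intervalIntegral.integral_const_mul, intervalIntegral.integral_deriv_eq_sub
            (fun t _ => (hθ.differentiable one_ne_zero) t) (hθd.intervalIntegrable a b),
          integral_primitive_mul_deriv hK hθ.contDiffOn]
    _ = W b * θ b - W a * θ a - ∫ t in a..b, K t * θ t := by
        rw [hW b right_mem_uIcc]
        ring

lemma integral_mul_deriv_deriv_eq_sub {F W θ : ℝ → ℝ} (hab : a ≤ b)
    (hF : ∀ t ∈ Icc a b, HasDerivWithinAt F (W t) (Icc a b) t) (hW : ContinuousOn W (Icc a b))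
    (hθ : ContDiff ℝ 2 θ) :
    ∫ t in a..b, F t * deriv (deriv θ) t
      = F b * deriv θ b - F a * deriv θ a - ∫ t in a..b, W t * deriv θ t := by
  have hθ1 : ContDiff ℝ 1 (deriv θ) := hθ.deriv'
  rw [← uIcc_of_le hab] at hF hW
  exact intervalIntegral.integral_mul_deriv_eq_deriv_mul_of_hasDerivWithinAt hF
    (fun t _ => (hθ1.differentiable one_ne_zero t).hasDerivAt.hasDerivWithinAt)
    hW.intervalIntegrable ((hθ1.continuous_deriv le_rfl).intervalIntegrable a b)

lemma integral_mul_deriv_deriv_eq_of_weak {F W K θ : ℝ → ℝ} (hab : a < b)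
    (hF : ∀ t ∈ Icc a b, HasDerivWithinAt F (W t) (Icc a b) t) (hW : ContinuousOn W (Icc a b))
    (hK : IntervalIntegrable K volume a b)
    (h : ∀ ξ : ℝ → ℝ, ContDiff ℝ ∞ ξ → HasCompactSupport ξ → tsupport ξ ⊆ Ioo a b →
      ∫ t in a..b, F t * deriv (deriv ξ) t = ∫ t in a..b, K t * ξ t)
    (hθ : ContDiff ℝ 2 θ) :
    ∫ t in a..b, F t * deriv (deriv θ) t
      = (∫ t in a..b, K t * θ t) + (F b * deriv θ b - F a * deriv θ a)
        - (W b * θ b - W a * θ a) := by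
  have hprim : ∀ t ∈ uIcc a b, W t = W a + ∫ s in a..t, K s := by
    rw [uIcc_of_le hab.le]
    refine fun t => eq_add_integral_of_integral_mul_deriv_eq hab hW hK fun ξ hξ hξc hξs => ?_
    have hξ0 {s : ℝ} (hs : s ∉ Ioo a b) : deriv ξ s = 0 :=
      image_eq_zero_of_notMem_tsupport fun h => hs (hξs (tsupport_deriv_subset h))
    rw [← h ξ hξ hξc hξs, integral_mul_deriv_deriv_eq_sub hab.le hF hW (contDiff_infty.1 hξ 2),
      hξ0 fun h => h.1.false, hξ0 fun h => h.2.false]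
    ring
  rw [integral_mul_deriv_deriv_eq_sub hab.le hF hW hθ,
    integral_mul_deriv_of_eq_add_integral hK hprim (hθ.of_le one_le_two)]
  ring

end DuBoisReymond

section TimeCutoff

/-- The cutoff in time, decreasing from `1` at `t = 0` to `0` at `t = τ`. For conjugate exponents
`p`, `q` the power `2q` makes its first two derivatives dominated by its `1/p`-th power, and they
vanish to the order `j` at `t = 0`. It is meant for `0 ≤ t ≤ τ` only. -/
def timeCutoff (q : ℝ) (j : ℕ) (τ t : ℝ) : ℝ := (1 - (t / τ) ^ (j + 2)) ^ (2 * q)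

variable {p q τ t : ℝ} {j : ℕ}

lemma contDiff_timeCutoff (hq : 1 ≤ q) : ContDiff ℝ 2 (timeCutoff q j τ) :=
  (Real.contDiff_rpow_const_of_le (n := 2) (by push_cast; linarith)).comp
    (contDiff_const.sub ((contDiff_id.div_const τ).pow _))

lemma timeCutoff_zero : timeCutoff q j τ 0 = 1 := by
  simp [timeCutoff]

lemma timeCutoff_self (hq : 0 < q) (hτ : τ ≠ 0) : timeCutoff q j τ τ = 0 := by
  simp [timeCutoff, hτ, hq.ne']

lemma one_sub_div_pow_mem_Icc (ht : t ∈ Icc 0 τ) : 1 - (t / τ) ^ (j + 2) ∈ Icc (0 : ℝ) 1 := by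
  have hs : 0 ≤ t / τ := div_nonneg ht.1 (ht.1.trans ht.2)
  exact ⟨sub_nonneg.2 (pow_le_one₀ hs (div_le_one_of_le₀ ht.2 (ht.1.trans ht.2))),
    sub_le_self _ (by positivity)⟩

lemma timeCutoff_nonneg (ht : t ∈ Icc 0 τ) : 0 ≤ timeCutoff q j τ t :=
  Real.rpow_nonneg (one_sub_div_pow_mem_Icc ht).1 _

lemma timeCutoff_rpow_inv (hpq : p.HolderConjugate q) (ht : t ∈ Icc 0 τ) :
    timeCutoff q j τ t ^ p⁻¹ = (1 - (t / τ) ^ (j + 2)) ^ (2 * q - 2) := by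
  rw [timeCutoff, ← Real.rpow_mul (one_sub_div_pow_mem_Icc ht).1, ← hpq.symm.one_sub_inv]
  congr 1
  have := hpq.symm.ne_zero
  field_simp

lemma hasDerivAt_one_sub_div_pow (k : ℕ) :
    HasDerivAt (fun t => 1 - (t / τ) ^ (k + 1)) (-((k + 1) / τ * (t / τ) ^ k)) t := by
  refine ((((hasDerivAt_id t).div_const τ).fun_pow (k + 1)).const_sub 1).congr_deriv ?_
  simp only [id, add_tsub_cancel_right]
  push_cast
  ring

lemma deriv_timeCutoff (hq : 1 ≤ q) :
    deriv (timeCutoff q j τ) = fun t =>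
      -(2 * q * (j + 2) / τ) * ((t / τ) ^ (j + 1) * (1 - (t / τ) ^ (j + 2)) ^ (2 * q - 1)) := by
  ext t
  refine (((hasDerivAt_one_sub_div_pow (j + 1)).rpow_const
    (Or.inr (by linarith))).congr_deriv ?_).deriv
  push_cast
  ring

lemma deriv_deriv_timeCutoff (hq : 1 ≤ q) :
    deriv (deriv (timeCutoff q j τ)) t =
      -(2 * q * (j + 2) / τ ^ 2) * (t / τ) ^ j * ((j + 1) * (1 - (t / τ) ^ (j + 2)) ^ (2 * q - 1)
        - (2 * q - 1) * (j + 2) * (t / τ) ^ (j + 2) * (1 - (t / τ) ^ (j + 2)) ^ (2 * q - 2)) := by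
  have hpow : HasDerivAt (fun t => (t / τ) ^ (j + 1)) ((j + 1) / τ * (t / τ) ^ j) t := by
    simpa using (hasDerivAt_one_sub_div_pow (τ := τ) (t := t) j).const_sub 1
  have hrpow := (hasDerivAt_one_sub_div_pow (τ := τ) (t := t) (j + 1)).rpow_const (p := 2 * q - 1)
    (Or.inr (by linarith))
  rw [deriv_timeCutoff hq, ((hpow.fun_mul hrpow).const_mul _).deriv,
    show 2 * q - 1 - 1 = 2 * q - 2 by ring]
  push_cast
  ring

lemma deriv_timeCutoff_zero (hq : 1 ≤ q) : deriv (timeCutoff q j τ) 0 = 0 := by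
  simp [deriv_timeCutoff hq]

lemma deriv_timeCutoff_self (hq : 1 ≤ q) (hτ : τ ≠ 0) : deriv (timeCutoff q j τ) τ = 0 := by
  have hq' : 2 * q - 1 ≠ 0 := by linarith
  simp [deriv_timeCutoff hq, hτ, hq']

lemma exists_abs_deriv_timeCutoff_le (hpq : p.HolderConjugate q) (j : ℕ) :
    ∃ B > 0, ∀ τ > 0, ∀ t ∈ Icc 0 τ,
      |deriv (timeCutoff q j τ) t| ≤ B / τ * (t / τ) ^ j * timeCutoff q j τ t ^ p⁻¹ ∧
      |deriv (deriv (timeCutoff q j τ)) t|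
        ≤ B / τ ^ 2 * (t / τ) ^ j * timeCutoff q j τ t ^ p⁻¹ := by
  have hq := hpq.symm.lt
  have hB : 1 ≤ (j + 1) + (2 * q - 1) * (j + 2) := by nlinarith [(j.cast_nonneg : (0 : ℝ) ≤ j)]
  refine ⟨2 * q * (j + 2) * ((j + 1) + (2 * q - 1) * (j + 2)), by positivity,
    fun τ hτ t ht => ?_⟩
  rw [deriv_deriv_timeCutoff hq.le, deriv_timeCutoff hq.le, timeCutoff_rpow_inv hpq ht]
  obtain ⟨hζ0, hζ1⟩ := one_sub_div_pow_mem_Icc (j := j) ht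
  have hs0 : 0 ≤ t / τ := div_nonneg ht.1 hτ.le
  have hs1 : t / τ ≤ 1 := div_le_one_of_le₀ ht.2 hτ.le
  have hζ2 : (1 - (t / τ) ^ (j + 2)) ^ (2 * q - 1) ≤ (1 - (t / τ) ^ (j + 2)) ^ (2 * q - 2) :=
    Real.rpow_le_rpow_of_exponent_ge_of_imp hζ0 hζ1 (by linarith) fun _ h => by linarith
  have hpow : (t / τ) ^ (j + 1) ≤ (t / τ) ^ j := pow_le_pow_of_le_one hs0 hs1 j.le_succ
  have hq1 : 0 ≤ 2 * q - 1 := by linarith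
  constructor
  · rw [abs_mul, abs_neg, abs_of_nonneg (by positivity), abs_of_nonneg (by positivity)]
    calc 2 * q * (j + 2) / τ * ((t / τ) ^ (j + 1) * (1 - (t / τ) ^ (j + 2)) ^ (2 * q - 1))
        ≤ 2 * q * (j + 2) / τ * ((t / τ) ^ j * (1 - (t / τ) ^ (j + 2)) ^ (2 * q - 2)) := by gcongr
      _ = 2 * q * (j + 2) * 1 / τ * (t / τ) ^ j * (1 - (t / τ) ^ (j + 2)) ^ (2 * q - 2) := by ring
      _ ≤ _ := by gcongr
  · rw [abs_mul, abs_mul, abs_neg, abs_of_nonneg (a := 2 * q * (j + 2) / τ ^ 2) (by positivity),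
      abs_of_nonneg (a := (t / τ) ^ j) (by positivity)]
    calc _ ≤ 2 * q * (j + 2) / τ ^ 2 * (t / τ) ^ j *
          ((j + 1) * (1 - (t / τ) ^ (j + 2)) ^ (2 * q - 2)
            + (2 * q - 1) * (j + 2) * 1 * (1 - (t / τ) ^ (j + 2)) ^ (2 * q - 2)) := by
          gcongr
          refine (abs_sub _ _).trans (add_le_add ?_ ?_) <;> rw [abs_of_nonneg (by positivity)]
          · gcongr
          · gcongr
            exact pow_le_one₀ hs0 hs1
      _ = _ := by ring

end TimeCutoff

section LowerSemicontinuity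

variable {α E : Type*} [MeasurableSpace α] [NormedAddCommGroup E] {μ ν : Measure α}

lemma lowerSemicontinuous_lintegral_enorm_rpow {r : ℝ≥0∞} [Fact (1 ≤ r)] (hν : ν ≪ μ) {p : ℝ} :
    LowerSemicontinuous fun w : Lp E r μ => ∫⁻ x, ‖w x‖ₑ ^ p ∂ν := by
  refine lowerSemicontinuous_iff_isClosed_preimage.2 fun y =>
    IsSeqClosed.isClosed fun w w₀ hw hlim => ?_
  obtain ⟨k, -, hk⟩ := (tendstoInMeasure_of_tendsto_Lp hlim).exists_seq_tendsto_ae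
  have hmeas (i : ℕ) : AEMeasurable (fun x => ‖w (k i) x‖ₑ ^ p) ν :=
    ((Lp.aestronglyMeasurable (w (k i))).mono_ac hν).enorm.pow_const p
  calc ∫⁻ x, ‖w₀ x‖ₑ ^ p ∂ν
      = ∫⁻ x, Filter.liminf (fun i => ‖w (k i) x‖ₑ ^ p) Filter.atTop ∂ν := by
        refine lintegral_congr_ae ?_
        filter_upwards [hν.ae_le hk] with x hx
        exact ((ENNReal.continuous_rpow_const.tendsto _).comp hx.enorm).liminf_eq.symm
    _ ≤ Filter.liminf (fun i => ∫⁻ x, ‖w (k i) x‖ₑ ^ p ∂ν) Filter.atTop :=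
        lintegral_liminf_le' hmeas
    _ ≤ y := Filter.liminf_le_of_le (by isBoundedDefault) fun b hb =>
        let ⟨i, hi⟩ := hb.exists
        hi.trans (hw (k i))

end LowerSemicontinuity

section Solutions

variable {n : ℕ} {p R ε T τ t c : ℝ} {f g : L2 n} {u v : ℝ → L2 n} {ψ : Space n → ℝ}

lemma integrable_mul_of_ae_eq_zero {K : Set (Space n)} {w : L2 n} (hK : IsCompact K)
    (hw : ∀ᵐ x, x ∉ K → w x = 0) (hψ : Continuous ψ) : Integrable fun x => w x * ψ x := by
  have hwK : IntegrableOn w K :=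
    ((Lp.memLp w).locallyIntegrable one_le_two).integrableOn_isCompact hK
  refine (hwK.mul_continuousOn hψ.continuousOn hK).integrable_of_ae_notMem_eq_zero ?_
  filter_upwards [hw] with x hx hxK using by rw [hx hxK, zero_mul]

lemma exists_continuousLinearMap_eq_setIntegral {K : Set (Space n)} (hK : IsCompact K)
    (hψ : Continuous ψ) : ∃ L : L2 n →L[ℝ] ℝ, ∀ w : L2 n, L w = ∫ x in K, w x * ψ x := by
  obtain ⟨M, hM⟩ := hK.exists_bound_of_continuousOn hψ.continuousOn
  have : IsFiniteMeasure (volume.restrict K) := isFiniteMeasure_restrict.2 hK.measure_lt_top.ne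
  have hmem : MemLp (K.indicator ψ) 2 := (memLp_indicator_iff_restrict hK.measurableSet).2 <|
    MemLp.of_bound hψ.aestronglyMeasurable M (ae_restrict_of_forall_mem hK.measurableSet hM)
  refine ⟨innerSL ℝ hmem.toLp, fun w => ?_⟩
  rw [innerSL_apply_apply, L2.inner_def, ← integral_indicator hK.measurableSet]
  refine integral_congr_ae ?_
  filter_upwards [hmem.coeFn_toLp] with x hx
  by_cases hxK : x ∈ K <;> simp [hx, hxK, mul_comm]

lemma IsSolution.ae_eq_zero_of_notMem_closedBall (h : IsSolution p R f g ε T u v) (hτT : τ < T)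
    (ht : t ∈ Icc 0 τ) :
    ∀ᵐ x, x ∉ Metric.closedBall (0 : Space n) (τ + R) → u t x = 0 ∧ v t x = 0 := by
  filter_upwards [h.support t ⟨ht.1, ht.2.trans_lt hτT⟩] with x hx hxK
  rw [mem_closedBall_zero_iff, not_le] at hxK
  exact hx (by linarith [ht.2])

lemma IsSolution.integrable_mul (h : IsSolution p R f g ε T u v) (ht : t ∈ Ico 0 T)
    (hψ : Continuous ψ) :
    Integrable (fun x => u t x * ψ x) ∧ Integrable fun x => v t x * ψ x := by
  have hK := isCompact_closedBall (0 : Space n) (t + R)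
  have h0 := h.ae_eq_zero_of_notMem_closedBall ht.2 ⟨ht.1, le_rfl⟩
  exact ⟨integrable_mul_of_ae_eq_zero hK (h0.mono fun x hx hxK => (hx hxK).1) hψ,
    integrable_mul_of_ae_eq_zero hK (h0.mono fun x hx hxK => (hx hxK).2) hψ⟩

lemma IsSolution.exists_continuousLinearMap_eq_integral (h : IsSolution p R f g ε T u v)
    (hτT : τ < T) (hψ : Continuous ψ) : ∃ L : L2 n →L[ℝ] ℝ, ∀ t ∈ Icc 0 τ,
      L (u t) = ∫ x, u t x * ψ x ∧ L (v t) = ∫ x, v t x * ψ x := by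
  obtain ⟨L, hL⟩ := exists_continuousLinearMap_eq_setIntegral
    (isCompact_closedBall (0 : Space n) (τ + R)) hψ
  refine ⟨L, fun t ht => ?_⟩
  rw [hL, hL]
  constructor <;> refine setIntegral_eq_integral_of_ae_compl_eq_zero ?_ <;>
    filter_upwards [h.ae_eq_zero_of_notMem_closedBall hτT ht] with x hx hxK
  · rw [(hx hxK).1, zero_mul]
  · rw [(hx hxK).2, zero_mul]

lemma IsSolution.hasDerivWithinAt_integral_mul (h : IsSolution p R f g ε T u v) (hτT : τ < T)
    (hψ : Continuous ψ) (ht : t ∈ Icc 0 τ) :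
    HasDerivWithinAt (fun t => ∫ x, u t x * ψ x) (∫ x, v t x * ψ x) (Icc 0 τ) t := by
  obtain ⟨L, hL⟩ := h.exists_continuousLinearMap_eq_integral hτT hψ
  have hderiv := (h.deriv_u t ⟨ht.1, ht.2.trans_lt hτT⟩).mono (Icc_subset_Ico_right hτT)
  rw [← (hL t ht).2]
  exact (L.hasFDerivAt.comp_hasDerivWithinAt t hderiv).congr_of_mem
    (fun s hs => (hL s hs).1.symm) ht

lemma IsSolution.continuousOn_integral_velocity_mul (h : IsSolution p R f g ε T u v) (hτT : τ < T)
    (hψ : Continuous ψ) : ContinuousOn (fun t => ∫ x, v t x * ψ x) (Icc 0 τ) := by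
  obtain ⟨L, hL⟩ := h.exists_continuousLinearMap_eq_integral hτT hψ
  exact (L.continuous.comp_continuousOn (h.continuous_v.mono (Icc_subset_Ico_right hτT))).congr
    fun t ht => (hL t ht).2.symm

lemma IsSolution.continuousOn_integral_mul (h : IsSolution p R f g ε T u v) (hτT : τ < T)
    (hψ : Continuous ψ) : ContinuousOn (fun t => ∫ x, u t x * ψ x) (Icc 0 τ) :=
  fun _ ht => (h.hasDerivWithinAt_integral_mul hτT hψ ht).continuousWithinAt

lemma IsSolution.aemeasurable_lintegral_enorm_rpow_mul (h : IsSolution p R f g ε T u v)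
    (hτ : 0 ≤ τ) (hτT : τ < T) (hψ : Continuous ψ) :
    AEMeasurable (fun t => ∫⁻ x, ‖u t x‖ₑ ^ p * ENNReal.ofReal (ψ x))
      (volume.restrict (Icc 0 τ)) := by
  have hψm : Measurable fun x => ENNReal.ofReal (ψ x) := hψ.measurable.ennreal_ofReal
  have hproj : Continuous fun t : ℝ => u (max 0 (min t τ)) :=
    h.continuous_u.1.comp_continuous (by fun_prop) fun t =>
      ⟨le_max_left _ _, (max_le hτ (min_le_right _ _)).trans_lt hτT⟩
  have hlsc := (lowerSemicontinuous_lintegral_enorm_rpow (p := p)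
    (withDensity_absolutelyContinuous volume fun x => ENNReal.ofReal (ψ x))).comp hproj
  refine hlsc.measurable.aemeasurable.congr ?_
  filter_upwards [ae_restrict_mem measurableSet_Icc] with t ht
  rw [Function.comp_apply, min_eq_left ht.2, max_eq_right ht.1,
    lintegral_withDensity_eq_lintegral_mul₀ hψm.aemeasurable
      ((Lp.aestronglyMeasurable (u t)).enorm.pow_const p)]
  simp only [Pi.mul_apply, mul_comm]

lemma IsSolution.lintegral_lintegral_enorm_rpow_mul_lt_top (h : IsSolution p R f g ε T u v)
    (hp : 0 < p) (hτ : 0 ≤ τ) (hτT : τ < T) (hψ : Continuous ψ) :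
    ∫⁻ t in Icc 0 τ, ∫⁻ x, ‖u t x‖ₑ ^ p * ENNReal.ofReal (ψ x) < ⊤ := by
  have hK := isCompact_closedBall (0 : Space n) (τ + R)
  obtain ⟨M, hM⟩ := hK.exists_bound_of_continuousOn hψ.continuousOn
  have hbound : ∀ t ∈ Icc 0 τ, ∫⁻ x, ‖u t x‖ₑ ^ p * ENNReal.ofReal (ψ x)
      ≤ (∫⁻ x in Metric.closedBall 0 (τ + R), ‖u t x‖ₑ ^ p) * ENNReal.ofReal M := fun t ht => by
    rw [← lintegral_mul_const' _ _ ENNReal.ofReal_ne_top, ← lintegral_indicator hK.measurableSet]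
    refine lintegral_mono_ae ?_
    filter_upwards [h.ae_eq_zero_of_notMem_closedBall hτT ht] with x hx
    by_cases hxK : x ∈ Metric.closedBall (0 : Space n) (τ + R)
    · rw [indicator_of_mem hxK]
      gcongr
      exact (le_abs_self _).trans (hM x hxK)
    · simp [(hx hxK).1, hp]
  calc ∫⁻ t in Icc 0 τ, ∫⁻ x, ‖u t x‖ₑ ^ p * ENNReal.ofReal (ψ x)
      ≤ ∫⁻ t in Icc 0 τ, (∫⁻ x in Metric.closedBall 0 (τ + R), ‖u t x‖ₑ ^ p)
          * ENNReal.ofReal M := setLIntegral_mono' measurableSet_Icc hbound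
    _ = (∫⁻ t in Icc 0 τ, ∫⁻ x in Metric.closedBall 0 (τ + R), ‖u t x‖ₑ ^ p)
          * ENNReal.ofReal M := lintegral_mul_const' _ _ ENNReal.ofReal_ne_top
    _ < ⊤ := ENNReal.mul_lt_top (h.locallyIntegrable τ ⟨hτ, hτT⟩ _ hK) ENNReal.ofReal_lt_top

lemma ofReal_abs_rpow_mul (hp : 0 ≤ p) (a b : ℝ) :
    ENNReal.ofReal (|a| ^ p * b) = ‖a‖ₑ ^ p * ENNReal.ofReal b := by
  rw [ENNReal.ofReal_mul (by positivity), ← ENNReal.ofReal_rpow_of_nonneg (abs_nonneg _) hp,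
    ← Real.enorm_eq_ofReal_abs]

lemma aestronglyMeasurable_abs_rpow_mul (w : L2 n) (p : ℝ) (hψ : Continuous ψ) :
    AEStronglyMeasurable fun x => |w x| ^ p * ψ x :=
  (((Lp.aestronglyMeasurable w).aemeasurable.abs.pow_const p).mul
    hψ.aemeasurable).aestronglyMeasurable

lemma IsSolution.ae_integrable_abs_rpow_mul (h : IsSolution p R f g ε T u v) (hp : 0 < p)
    (hτ : 0 ≤ τ) (hτT : τ < T) (hψ : Continuous ψ) (hψ0 : 0 ≤ ψ) :
    ∀ᵐ t ∂volume.restrict (Icc 0 τ), Integrable fun x => |u t x| ^ p * ψ x := by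
  filter_upwards [ae_lt_top' (h.aemeasurable_lintegral_enorm_rpow_mul hτ hτT hψ)
    (h.lintegral_lintegral_enorm_rpow_mul_lt_top hp hτ hτT hψ).ne] with t ht
  refine ⟨aestronglyMeasurable_abs_rpow_mul _ _ hψ, ?_⟩
  rw [hasFiniteIntegral_iff_ofReal (.of_forall fun x => mul_nonneg (by positivity) (hψ0 x))]
  simpa only [ofReal_abs_rpow_mul hp.le] using ht

lemma IsSolution.intervalIntegrable_integral_abs_rpow_mul (h : IsSolution p R f g ε T u v)
    (hp : 0 < p) (hτ : 0 ≤ τ) (hτT : τ < T) (hψ : Continuous ψ) (hψ0 : 0 ≤ ψ) :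
    IntervalIntegrable (fun t => ∫ x, |u t x| ^ p * ψ x) volume 0 τ := by
  have htoReal (t : ℝ) : ∫ x, |u t x| ^ p * ψ x
      = (∫⁻ x, ‖u t x‖ₑ ^ p * ENNReal.ofReal (ψ x)).toReal := by
    rw [integral_eq_lintegral_of_nonneg_ae (.of_forall fun x => mul_nonneg (by positivity) (hψ0 x))
      (aestronglyMeasurable_abs_rpow_mul _ _ hψ)]
    simp only [ofReal_abs_rpow_mul hp.le]
  simp only [htoReal]
  rw [intervalIntegrable_iff_integrableOn_Icc_of_le hτ]
  exact integrable_toReal_of_lintegral_ne_top (h.aemeasurable_lintegral_enorm_rpow_mul hτ hτT hψ)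
    (h.lintegral_lintegral_enorm_rpow_mul_lt_top hp hτ hτT hψ).ne

lemma exists_contDiff_hasCompactSupport_eventuallyEq (hψ : ContDiff ℝ ∞ ψ) (r : ℝ) :
    ∃ χ : Space n → ℝ, ContDiff ℝ ∞ χ ∧ HasCompactSupport χ ∧
      ∀ x ∈ Metric.closedBall 0 r, χ =ᶠ[nhds x] ψ := by
  let b : ContDiffBump (0 : Space n) := ⟨|r| + 1, |r| + 2, by positivity, by linarith⟩
  refine ⟨fun x => ψ x * b x, hψ.mul b.contDiff, b.hasCompactSupport.mul_left, fun x hx => ?_⟩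
  have hxr : ‖x‖ < |r| + 1 := by linarith [mem_closedBall_zero_iff.1 hx, le_abs_self r]
  filter_upwards [b.eventuallyEq_one_of_mem_ball (mem_ball_zero_iff.2 hxr)] with y hy
  rw [hy, Pi.one_apply, mul_one]

lemma SolvesWeakly.setIntegral_mul_eq (h : SolvesWeakly p u T) (hτT : τ ≤ T) {ξ : ℝ → ℝ}
    (hξ : ContDiff ℝ ∞ ξ) (hξc : HasCompactSupport ξ) (hξτ : tsupport ξ ⊆ Ioo 0 τ)
    (hψ : ContDiff ℝ ∞ ψ) (hψc : HasCompactSupport ψ) :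
    ∫ t in Ioo 0 τ, ∫ x, u t x * (deriv (deriv ξ) t * ψ x - ξ t * Laplacian.laplacian ψ x)
      = ∫ t in Ioo 0 τ, (∫ x, |u t x| ^ p * ψ x) * ξ t := by
  have hsupp : tsupport (fun z : ℝ × Space n => ξ z.1 * ψ z.2) ⊆ tsupport ξ ×ˢ tsupport ψ :=
    closure_minimal (fun z hz => (mul_ne_zero_iff.1 hz).imp (subset_tsupport _ ·)
      (subset_tsupport _ ·)) ((isClosed_tsupport _).prod (isClosed_tsupport _))
  have hweak := h (fun z => ξ z.1 * ψ z.2)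
    ((hξ.comp contDiff_fst).mul (hψ.comp contDiff_snd))
    ((hξc.isCompact.prod hψc.isCompact).of_isClosed_subset (isClosed_tsupport _) hsupp)
    (hsupp.trans (prod_mono (hξτ.trans (Ioo_subset_Ioo_right hτT)) (subset_univ _)))
  have hderiv (t : ℝ) (x : Space n) :
      iteratedDeriv 2 (fun s => ξ s * ψ x) t = deriv (deriv ξ) t * ψ x := by
    simp [iteratedDeriv_succ]
  have hΔ (t : ℝ) (x : Space n) :
      Laplacian.laplacian (fun y => ξ t * ψ y) x = ξ t * Laplacian.laplacian ψ x :=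
    InnerProductSpace.laplacian_smul (ξ t) (contDiff_infty.1 hψ 2).contDiffAt
  have hmul (t : ℝ) : ∫ x, |u t x| ^ p * (ξ t * ψ x) = (∫ x, |u t x| ^ p * ψ x) * ξ t := by
    rw [← integral_mul_const]
    congr! 2
    ring
  have hξ0 {t : ℝ} (ht : t ∈ Ioo 0 T \ Ioo 0 τ) : ξ t = 0 ∧ deriv (deriv ξ) t = 0 := by
    have hξt : t ∉ tsupport ξ := fun hm => ht.2 (hξτ hm)
    exact ⟨image_eq_zero_of_notMem_tsupport hξt, image_eq_zero_of_notMem_tsupport fun hm =>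
      hξt (tsupport_deriv_subset (tsupport_deriv_subset hm))⟩
  simp only [hderiv, hΔ, hmul] at hweak
  rwa [setIntegral_eq_of_subset_of_forall_sdiff_eq_zero measurableSet_Ioo
      (Ioo_subset_Ioo_right hτT) fun t ht => by simp [hξ0 ht],
    setIntegral_eq_of_subset_of_forall_sdiff_eq_zero measurableSet_Ioo
      (Ioo_subset_Ioo_right hτT) fun t ht => by simp [hξ0 ht]] at hweak

lemma IsSolution.setIntegral_mul_eq (h : IsSolution p R f g ε T u v) (hp : 0 < p)
    (hτT : τ < T) (hψ : ContDiff ℝ ∞ ψ) (hc : ∀ x, Laplacian.laplacian ψ x = c * ψ x)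
    {ξ : ℝ → ℝ} (hξ : ContDiff ℝ ∞ ξ) (hξc : HasCompactSupport ξ) (hξτ : tsupport ξ ⊆ Ioo 0 τ) :
    ∫ t in Ioo 0 τ, (∫ x, u t x * ψ x) * (deriv (deriv ξ) t - c * ξ t)
      = ∫ t in Ioo 0 τ, (∫ x, |u t x| ^ p * ψ x) * ξ t := by
  -- by finite propagation speed, `u` does not see a cutoff of `ψ` outside the light cone
  obtain ⟨χ, hχ, hχc, hχψ⟩ := exists_contDiff_hasCompactSupport_eventuallyEq hψ (τ + R)
  have hae {t : ℝ} (ht : t ∈ Ioo 0 τ) :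
      ∀ᵐ x, u t x = 0 ∨ χ x = ψ x ∧ Laplacian.laplacian χ x = c * ψ x := by
    filter_upwards [h.ae_eq_zero_of_notMem_closedBall hτT (Ioo_subset_Icc_self ht)] with x hx
    by_cases hxK : x ∈ Metric.closedBall 0 (τ + R)
    · exact .inr ⟨(hχψ x hxK).eq_of_nhds,
        (InnerProductSpace.laplacian_congr_nhds (hχψ x hxK)).eq_of_nhds.trans (hc x)⟩
    · exact .inl (hx hxK).1
  calc ∫ t in Ioo 0 τ, (∫ x, u t x * ψ x) * (deriv (deriv ξ) t - c * ξ t)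
      = ∫ t in Ioo 0 τ, ∫ x, u t x *
          (deriv (deriv ξ) t * χ x - ξ t * Laplacian.laplacian χ x) := by
        refine setIntegral_congr_fun measurableSet_Ioo fun t ht => ?_
        rw [← integral_mul_const]
        refine integral_congr_ae ?_
        filter_upwards [hae ht] with x hx
        rcases hx with hx | ⟨hx, hΔx⟩
        · simp only [hx, zero_mul]
        · rw [hx, hΔx]
          ring
    _ = ∫ t in Ioo 0 τ, (∫ x, |u t x| ^ p * χ x) * ξ t :=
        h.equation.setIntegral_mul_eq hτT.le hξ hξc hξτ hχ hχc
    _ = ∫ t in Ioo 0 τ, (∫ x, |u t x| ^ p * ψ x) * ξ t := by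
        refine setIntegral_congr_fun measurableSet_Ioo fun t ht => ?_
        congr 1
        refine integral_congr_ae ?_
        filter_upwards [hae ht] with x hx
        rcases hx with hx | ⟨hx, -⟩
        · simp only [hx, abs_zero, Real.zero_rpow hp.ne', zero_mul]
        · rw [hx]

lemma integral_smul_coeFn_mul (w : L2 n) (ψ : Space n → ℝ) (a : ℝ) :
    ∫ x, (a • w : L2 n) x * ψ x = a * ∫ x, w x * ψ x := by
  rw [← integral_const_mul]
  refine integral_congr_ae ?_
  filter_upwards [Lp.coeFn_smul a w] with x hx
  rw [hx, Pi.smul_apply, smul_eq_mul, mul_assoc]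

lemma IsSolution.integral_mul_eigenfunction_eq (h : IsSolution p R f g ε T u v) (hp : 0 < p)
    (hτ : 0 < τ) (hτT : τ < T) (hψ : ContDiff ℝ ∞ ψ) (hψ0 : 0 ≤ ψ)
    (hc : ∀ x, Laplacian.laplacian ψ x = c * ψ x) {θ : ℝ → ℝ} (hθ : ContDiff ℝ 2 θ)
    (hθτ : θ τ = 0) (hθτ' : deriv θ τ = 0) :
    ∫ t in (0 : ℝ)..τ, (∫ x, u t x * ψ x) * (deriv (deriv θ) t - c * θ t)
      = (∫ t in (0 : ℝ)..τ, (∫ x, |u t x| ^ p * ψ x) * θ t)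
        + ε * (∫ x, g x * ψ x) * θ 0 - ε * (∫ x, f x * ψ x) * deriv θ 0 := by
  set F : ℝ → ℝ := fun t => ∫ x, u t x * ψ x
  set P : ℝ → ℝ := fun t => ∫ x, |u t x| ^ p * ψ x
  have hF : IntervalIntegrable F volume 0 τ :=
    (h.continuousOn_integral_mul hτT hψ.continuous).intervalIntegrable_of_Icc hτ.le
  have hP : IntervalIntegrable P volume 0 τ :=
    h.intervalIntegrable_integral_abs_rpow_mul hp hτ.le hτT hψ.continuous hψ0
  have hsplit {ξ : ℝ → ℝ} (hξ : ContDiff ℝ 2 ξ) :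
      (∫ t in (0 : ℝ)..τ, F t * deriv (deriv ξ) t) - ∫ t in (0 : ℝ)..τ, (c * F t + P t) * ξ t
        = (∫ t in (0 : ℝ)..τ, F t * (deriv (deriv ξ) t - c * ξ t))
          - ∫ t in (0 : ℝ)..τ, P t * ξ t := by
    have hξ'' : Continuous (deriv (deriv ξ)) := (hξ.iterate_deriv' 0 2).continuous
    rw [← intervalIntegral.integral_sub, ← intervalIntegral.integral_sub]
    · congr! 2
      ring
    · exact hF.mul_continuousOn (hξ''.sub (continuous_const.mul hξ.continuous)).continuousOn
    · exact hP.mul_continuousOn hξ.continuous.continuousOn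
    · exact hF.mul_continuousOn hξ''.continuousOn
    · exact ((hF.const_mul c).add hP).mul_continuousOn hξ.continuous.continuousOn
  have hweak (ξ : ℝ → ℝ) (hξ : ContDiff ℝ ∞ ξ) (hξc : HasCompactSupport ξ)
      (hξτ : tsupport ξ ⊆ Ioo 0 τ) :
      ∫ t in (0 : ℝ)..τ, F t * deriv (deriv ξ) t
        = ∫ t in (0 : ℝ)..τ, (c * F t + P t) * ξ t := by
    have htest := h.setIntegral_mul_eq hp hτT hψ hc hξ hξc hξτ
    simp only [← integral_Ioc_eq_integral_Ioo, ← intervalIntegral.integral_of_le hτ.le] at htest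
    linarith [hsplit (contDiff_infty.1 hξ 2)]
  have hparts := integral_mul_deriv_deriv_eq_of_weak hτ
    (fun t ht => h.hasDerivWithinAt_integral_mul hτT hψ.continuous ht)
    (h.continuousOn_integral_velocity_mul hτT hψ.continuous) ((hF.const_mul c).add hP) hweak hθ
  rw [hθτ, hθτ', h.initial_u, h.initial_v, integral_smul_coeFn_mul, integral_smul_coeFn_mul]
    at hparts
  linarith [hsplit hθ]

end Solutions

section Young

variable {p q lam : ℝ}

lemma mul_mul_le_young {a A b e : ℝ} (hpq : p.HolderConjugate q) (hlam : 0 < lam) (hA : 0 ≤ A)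
    (hb : 0 ≤ b) (he : 0 ≤ e) (ha : |a| ≤ A * e ^ p⁻¹) (w : ℝ) :
    w * b * a ≤ lam ^ p / p * (|w| ^ p * e) + lam ^ (-q) / q * (A * b) ^ q :=
  calc w * b * a ≤ |w * b * a| := le_abs_self _
    _ = |w| * b * |a| := by rw [abs_mul, abs_mul, abs_of_nonneg hb]
    _ ≤ |w| * b * (A * e ^ p⁻¹) := by gcongr
    _ = lam * |w| * e ^ p⁻¹ * (lam⁻¹ * (A * b)) := by field_simp
    _ ≤ (lam * |w| * e ^ p⁻¹) ^ p / p + (lam⁻¹ * (A * b)) ^ q / q :=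
        Real.young_inequality_of_nonneg (by positivity) (by positivity) hpq
    _ = lam ^ p / p * (|w| ^ p * e) + lam ^ (-q) / q * (A * b) ^ q := by
        rw [Real.mul_rpow (by positivity) (by positivity), Real.mul_rpow hlam.le (abs_nonneg w),
          Real.rpow_inv_rpow he hpq.ne_zero, Real.mul_rpow (by positivity) (by positivity),
          Real.inv_rpow hlam.le, Real.rpow_neg hlam.le]
        ring

lemma integral_mul_mul_le_young {α : Type*} [MeasurableSpace α] {μ : Measure α} {K : Set α}
    {w ψ : α → ℝ} {a A e : ℝ} (hpq : p.HolderConjugate q) (hlam : 0 < lam) (hA : 0 ≤ A)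
    (he : 0 ≤ e) (ha : |a| ≤ A * e ^ p⁻¹) (hK : MeasurableSet K) (hψ0 : 0 ≤ ψ)
    (hψ : IntegrableOn (fun x => (A * ψ x) ^ q) K μ) (hw0 : ∀ᵐ x ∂μ, x ∉ K → w x = 0)
    (hwψ : Integrable (fun x => w x * ψ x) μ) (hw : Integrable (fun x => |w x| ^ p) μ) :
    (∫ x, w x * ψ x ∂μ) * a
      ≤ lam ^ p / p * ((∫ x, |w x| ^ p ∂μ) * e) + lam ^ (-q) / q * ∫ x in K, (A * ψ x) ^ q ∂μ := by
  have hw' := (hw.mul_const e).const_mul (lam ^ p / p)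
  have hψ' := (integrable_indicator_iff hK).2 (hψ.const_mul (lam ^ (-q) / q))
  rw [← integral_mul_const, ← integral_mul_const, ← integral_const_mul, ← integral_const_mul,
    ← integral_indicator hK, ← integral_add hw' hψ']
  refine integral_mono_ae (hwψ.mul_const a) (hw'.add hψ') ?_
  filter_upwards [hw0] with x hx
  by_cases hxK : x ∈ K
  · simpa only [indicator_of_mem hxK] using mul_mul_le_young hpq hlam hA (hψ0 x) he ha (w x)
  · simp [hx hxK, hxK, hpq.ne_zero]

end Young

section Estimates

variable {n : ℕ} {p q R ε T τ t s lam : ℝ} {f g : L2 n} {u v : ℝ → L2 n} {j : ℕ}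

lemma IsSolution.integral_mul_le_young {ψ : Space n → ℝ} {a A η : ℝ → ℝ} {D : ℝ}
    (h : IsSolution p R f g ε T u v)
    (hpq : p.HolderConjugate q) (hτ : 0 ≤ τ) (hτT : τ < T) (hlam : 0 < lam)
    (hψ : Continuous ψ) (hψ0 : 0 ≤ ψ) (ha : Continuous a) (hη : Continuous η)
    (hA0 : ∀ t ∈ Icc 0 τ, 0 ≤ A t) (hη0 : ∀ t ∈ Icc 0 τ, 0 ≤ η t)
    (haA : ∀ t ∈ Icc 0 τ, |a t| ≤ A t * η t ^ p⁻¹)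
    (hD : ∀ t ∈ Icc 0 τ, ∫ x in Metric.closedBall 0 (t + R), (A t * ψ x) ^ q ≤ D) :
    ∫ t in (0 : ℝ)..τ, (∫ x, u t x * ψ x) * a t
      ≤ lam ^ p / p * (∫ t in (0 : ℝ)..τ, (∫ x, |u t x| ^ p) * η t)
        + lam ^ (-q) / q * (τ * D) := by
  have hq := hpq.symm.pos
  have hone : (0 : Space n → ℝ) ≤ fun _ => 1 := fun _ => zero_le_one
  have hu : ∀ᵐ t ∂volume.restrict (Icc 0 τ), Integrable fun x => |u t x| ^ p := by
    simpa only [mul_one] using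
      h.ae_integrable_abs_rpow_mul hpq.pos hτ hτT continuous_const hone
  have hP : IntervalIntegrable (fun t => ∫ x, |u t x| ^ p) volume 0 τ := by
    simpa only [mul_one] using
      h.intervalIntegrable_integral_abs_rpow_mul hpq.pos hτ hτT continuous_const hone
  have hPη := (hP.mul_continuousOn hη.continuousOn).const_mul (lam ^ p / p)
  calc ∫ t in (0 : ℝ)..τ, (∫ x, u t x * ψ x) * a t
      ≤ ∫ t in (0 : ℝ)..τ,
          (lam ^ p / p * ((∫ x, |u t x| ^ p) * η t) + lam ^ (-q) / q * D) := by
        refine intervalIntegral.integral_mono_ae_restrict hτ ?_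
          (hPη.add intervalIntegrable_const) ?_
        · exact ((h.continuousOn_integral_mul hτT hψ).intervalIntegrable_of_Icc hτ).mul_continuousOn
            ha.continuousOn
        filter_upwards [hu, ae_restrict_mem measurableSet_Icc] with t hut ht
        have hK := isCompact_closedBall (0 : Space n) (t + R)
        refine (integral_mul_mul_le_young hpq hlam (hA0 t ht) (hη0 t ht) (haA t ht)
          hK.measurableSet hψ0 ?_ ?_ (h.integrable_mul ⟨ht.1, ht.2.trans_lt hτT⟩ hψ).1 hut).trans ?_
        · exact ((continuous_const.mul hψ).rpow_const fun _ =>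
            .inr hq.le).continuousOn.integrableOn_compact hK
        · filter_upwards [h.ae_eq_zero_of_notMem_closedBall (ht.2.trans_lt hτT) ⟨ht.1, le_rfl⟩]
            with x hx hxK using (hx hxK).1
        · gcongr
          exact hD t ht
    _ = _ := by
        rw [intervalIntegral.integral_add hPη intervalIntegrable_const,
          intervalIntegral.integral_const_mul, intervalIntegral.integral_const, sub_zero,
          smul_eq_mul]
        ring

lemma setIntegral_closedBall_div_sq_rpow_le {B : ℝ} (hR : 0 ≤ R) (hB : 0 ≤ B) (hτ : 1 ≤ τ)
    (ht : t ∈ Icc 0 τ) (q : ℝ) :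
    ∫ _x in Metric.closedBall (0 : Space n) (t + R), (B / τ ^ 2) ^ q
      ≤ B ^ q * (1 + R) ^ n * volume.real (Metric.ball (0 : Space n) 1) * τ ^ (n - 2 * q) := by
  have hτ0 : 0 < τ := by linarith
  have hball : (t + R) ^ n ≤ (1 + R) ^ n * τ ^ n := by
    rw [← mul_pow]
    have := ht.1
    gcongr
    nlinarith [ht.2]
  rw [setIntegral_const, Measure.addHaar_real_closedBall _ _ (add_nonneg ht.1 hR),
    finrank_euclideanSpace, Fintype.card_fin, smul_eq_mul]
  calc (t + R) ^ n * volume.real (Metric.ball (0 : Space n) 1) * (B / τ ^ 2) ^ q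
      ≤ (1 + R) ^ n * τ ^ n * volume.real (Metric.ball (0 : Space n) 1) * (B / τ ^ 2) ^ q := by
        gcongr
    _ = _ := by
        rw [Real.div_rpow hB (by positivity), ← Real.rpow_natCast τ 2, ← Real.rpow_mul hτ0.le,
          Real.rpow_sub hτ0, Real.rpow_natCast, Nat.cast_ofNat]
        ring

lemma IsSolution.integral_abs_rpow_mul_timeCutoff_le (h : IsSolution p R f g ε T u v)
    (hpq : p.HolderConjugate q) (hg : 0 ≤ g) (hε : 0 ≤ ε) (hτ : 0 < τ) (hτT : τ < T) :
    ∫ t in (0 : ℝ)..τ, (∫ x, |u t x| ^ p) * timeCutoff q j τ t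
      ≤ ∫ t in (0 : ℝ)..τ, (∫ x, u t x * 1) * deriv (deriv (timeCutoff q j τ)) t := by
  have hq := hpq.symm.lt.le
  have htest := h.integral_mul_eigenfunction_eq (c := 0) hpq.pos hτ hτT contDiff_const
    (fun _ => zero_le_one) (fun x => by rw [InnerProductSpace.laplacian_const]; simp)
    (contDiff_timeCutoff (j := j) hq) (timeCutoff_self hpq.symm.pos hτ.ne')
    (deriv_timeCutoff_self hq hτ.ne')
  have hg0 : 0 ≤ ∫ x, g x := integral_nonneg_of_ae ((Lp.coeFn_nonneg g).2 hg)
  simp only [deriv_timeCutoff_zero hq, timeCutoff_zero, zero_mul, sub_zero, mul_one,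
    mul_zero] at htest ⊢
  rw [htest]
  exact le_add_of_nonneg_right (mul_nonneg hε hg0)

lemma exists_integral_abs_rpow_mul_timeCutoff_le (n : ℕ) (hpq : p.HolderConjugate q) (hR : 0 ≤ R)
    (j : ℕ) : ∃ C > 0, ∀ (f g : L2 n) (u v : ℝ → L2 n) (ε T τ : ℝ), 0 ≤ g → 0 ≤ ε →
      IsSolution p R f g ε T u v → 1 ≤ τ → τ < T →
        ∫ t in (0 : ℝ)..τ, (∫ x, |u t x| ^ p) * timeCutoff q j τ t
          ≤ C * τ ^ (n + 1 - 2 * q) := by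
  obtain ⟨B, hB, hBη⟩ := exists_abs_deriv_timeCutoff_le hpq j
  have hV : 0 < volume.real (Metric.ball (0 : Space n) 1) :=
    ENNReal.toReal_pos (Metric.measure_ball_pos _ _ one_pos).ne' measure_ball_lt_top.ne
  refine ⟨B ^ q * (1 + R) ^ n * volume.real (Metric.ball (0 : Space n) 1), by positivity,
    fun f g u v ε T τ hg hε h hτ hτT => ?_⟩
  have hτ0 : 0 < τ := by linarith
  have hη : ContDiff ℝ 2 (timeCutoff q j τ) := contDiff_timeCutoff hpq.symm.lt.le
  have hη'' : ∀ t ∈ Icc 0 τ,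
      |deriv (deriv (timeCutoff q j τ)) t| ≤ B / τ ^ 2 * timeCutoff q j τ t ^ p⁻¹ := by
    intro t ht
    have hη0 := timeCutoff_nonneg (q := q) (j := j) ht
    have ht0 := ht.1
    refine (hBη τ hτ0 t ht).2.trans ?_
    gcongr
    exact mul_le_of_le_one_right (by positivity)
      (pow_le_one₀ (by positivity) (div_le_one_of_le₀ ht.2 hτ0.le))
  have hyoung := h.integral_mul_le_young (ψ := fun _ => 1) (A := fun _ => B / τ ^ 2) hpq hτ0.le hτT
    one_pos continuous_const (fun _ => zero_le_one) (hη.iterate_deriv' 0 2).continuous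
    hη.continuous (fun _ _ => by positivity) (fun _ => timeCutoff_nonneg) hη''
    (fun t ht => by
      simpa only [mul_one] using setIntegral_closedBall_div_sq_rpow_le hR hB.le hτ ht q)
  set X := ∫ t in (0 : ℝ)..τ, (∫ x, |u t x| ^ p) * timeCutoff q j τ t
  rw [Real.one_rpow, Real.one_rpow, one_div, one_div] at hyoung
  refine le_of_mul_le_mul_left ?_ (inv_pos.2 hpq.symm.pos)
  calc q⁻¹ * X = X - p⁻¹ * X := by linear_combination X * hpq.inv_add_inv_eq_one
    _ ≤ _ := sub_le_iff_le_add'.2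
        ((h.integral_abs_rpow_mul_timeCutoff_le hpq hg hε hτ0 hτT).trans hyoung)
    _ = _ := by
        rw [add_sub_right_comm, Real.rpow_add_one hτ0.ne']
        ring

lemma div_pow_rpow_mul_one_add_rpow_le (hτ : 1 ≤ τ) (ht : t ∈ Icc 0 τ)
    (hj : |s| ≤ j * q) : ((t / τ) ^ j) ^ q * (1 + t) ^ s ≤ 2 ^ |s| * τ ^ s := by
  obtain ⟨ht0, htτ⟩ := ht
  have hτ0 : 0 < τ := by linarith
  have hpow : ((t / τ) ^ j) ^ q ≤ (t / τ) ^ |s| := by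
    rw [← Real.rpow_natCast, ← Real.rpow_mul (by positivity)]
    exact Real.rpow_le_rpow_of_exponent_ge' (by positivity) (div_le_one_of_le₀ htτ hτ0.le)
      (abs_nonneg s) hj
  refine (mul_le_mul_of_nonneg_right hpow (by positivity)).trans ?_
  rcases le_total 0 s with hs | hs
  · rw [abs_of_nonneg hs, ← Real.mul_rpow (by positivity) (by positivity),
      ← Real.mul_rpow (by positivity) (by positivity), div_mul_eq_mul_div]
    gcongr
    rw [div_le_iff₀ hτ0]
    nlinarith
  · calc (t / τ) ^ |s| * (1 + t) ^ s = (t / (1 + t)) ^ (-s) * τ ^ s := by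
          rw [abs_of_nonpos hs, Real.div_rpow ht0 hτ0.le, Real.div_rpow ht0 (by positivity),
            Real.rpow_neg hτ0.le, Real.rpow_neg (x := 1 + t) (by positivity), div_inv_eq_mul,
            div_inv_eq_mul]
          ring
      _ ≤ 1 * τ ^ s := by
          gcongr
          exact Real.rpow_le_one (by positivity) (div_le_one_of_le₀ (by linarith) (by positivity))
            (neg_nonneg.2 hs)
      _ ≤ 2 ^ |s| * τ ^ s := by
          gcongr
          exact Real.one_le_rpow one_le_two (abs_nonneg s)

lemma exists_integral_mul_radialEigenfunction_rpow_le {B : ℝ} (hn : 1 ≤ n) (hq : 0 < q)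
    (hR : 0 ≤ R) (hB : 0 < B) (hs : s = (n - 1) * (1 - q / 2)) (hj : |s| ≤ j * q) :
    ∃ C > 0, ∀ τ ≥ 1, ∀ t ∈ Icc 0 τ, ∫ x in Metric.closedBall (0 : Space n) (t + R),
      (B / τ * (t / τ) ^ j * Real.exp (-t) * radialEigenfunction n x) ^ q ≤ C * τ ^ (s - q) := by
  obtain ⟨C, hC, hCφ⟩ := exists_integral_radialEigenfunction_mul_exp_rpow_le hn hq hR
  refine ⟨B ^ q * C * 2 ^ |s|, by positivity, fun τ hτ t ht => ?_⟩
  have hτ0 : 0 < τ := by linarith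
  have ht0 := ht.1
  have hsplit (x : Space n) :
      (B / τ * (t / τ) ^ j * Real.exp (-t) * radialEigenfunction n x) ^ q
        = (B / τ) ^ q * ((t / τ) ^ j) ^ q * (radialEigenfunction n x * Real.exp (-t)) ^ q := by
    have hφ := zero_le_one.trans (one_le_radialEigenfunction hn x)
    rw [mul_assoc _ (Real.exp _), mul_comm (Real.exp _), Real.mul_rpow (by positivity)
      (by positivity), Real.mul_rpow (by positivity) (by positivity)]
  simp only [hsplit, integral_const_mul]
  calc (B / τ) ^ q * ((t / τ) ^ j) ^ q *
        ∫ x in Metric.closedBall 0 (t + R), (radialEigenfunction n x * Real.exp (-t)) ^ q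
      ≤ (B / τ) ^ q * ((t / τ) ^ j) ^ q * (C * (1 + t) ^ s) := by
        rw [hs]
        gcongr
        exact hCφ t ht0
    _ = (B / τ) ^ q * C * (((t / τ) ^ j) ^ q * (1 + t) ^ s) := by ring
    _ ≤ (B / τ) ^ q * C * (2 ^ |s| * τ ^ s) :=
        mul_le_mul_of_nonneg_left (div_pow_rpow_mul_one_add_rpow_le hτ ht hj)
          (by positivity)
    _ = B ^ q * C * 2 ^ |s| * τ ^ (s - q) := by
        rw [Real.div_rpow hB.le hτ0.le, Real.rpow_sub hτ0]
        ring

lemma deriv_exp_neg_mul {η : ℝ → ℝ} (hη : Differentiable ℝ η) (t : ℝ) :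
    deriv (fun t => Real.exp (-t) * η t) t = Real.exp (-t) * (deriv η t - η t) := by
  have hexp : HasDerivAt (fun t : ℝ => Real.exp (-t)) (-Real.exp (-t)) t := by
    simpa only [mul_neg_one] using (hasDerivAt_neg t).exp
  rw [(hexp.fun_mul (hη t).hasDerivAt).deriv]
  ring

lemma deriv_deriv_exp_neg_mul {η : ℝ → ℝ} (hη : ContDiff ℝ 2 η) (t : ℝ) :
    deriv (deriv fun t => Real.exp (-t) * η t) t
      = Real.exp (-t) * (deriv (deriv η) t - 2 * deriv η t + η t) := by
  have hη0 : Differentiable ℝ η := hη.differentiable two_ne_zero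
  have hη1 : Differentiable ℝ (deriv η) := hη.differentiable_deriv_two
  rw [funext (deriv_exp_neg_mul hη0), deriv_exp_neg_mul (hη1.fun_sub hη0),
    deriv_fun_sub (hη1 t) (hη0 t)]
  ring

lemma exists_abs_exp_neg_mul_deriv_timeCutoff_le (hpq : p.HolderConjugate q) (j : ℕ) :
    ∃ B > 0, ∀ τ ≥ 1, ∀ t ∈ Icc 0 τ,
      |Real.exp (-t) * (deriv (deriv (timeCutoff q j τ)) t - 2 * deriv (timeCutoff q j τ) t)|
        ≤ B / τ * (t / τ) ^ j * Real.exp (-t) * timeCutoff q j τ t ^ p⁻¹ := by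
  obtain ⟨B, hB, hBη⟩ := exists_abs_deriv_timeCutoff_le hpq j
  refine ⟨3 * B, by positivity, fun τ hτ t ht => ?_⟩
  have hτ0 : 0 < τ := by linarith
  set η := timeCutoff q j τ
  have hη0 : 0 ≤ η t := timeCutoff_nonneg ht
  have ht0 := ht.1
  obtain ⟨hη', hη''⟩ := hBη τ hτ0 t ht
  have hη''τ : |deriv (deriv η) t| ≤ B / τ * (t / τ) ^ j * η t ^ p⁻¹ := by
    refine hη''.trans ?_
    gcongr
    exact le_self_pow₀ hτ two_ne_zero
  rw [abs_mul, Real.abs_exp, mul_right_comm, mul_comm (Real.exp _)]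
  gcongr
  calc |deriv (deriv η) t - 2 * deriv η t|
      ≤ |deriv (deriv η) t| + 2 * |deriv η t| := by
        simpa only [abs_mul, abs_two] using abs_sub (deriv (deriv η) t) (2 * deriv η t)
    _ ≤ B / τ * (t / τ) ^ j * η t ^ p⁻¹ + 2 * (B / τ * (t / τ) ^ j * η t ^ p⁻¹) := by gcongr
    _ = 3 * B / τ * (t / τ) ^ j * η t ^ p⁻¹ := by ring

lemma IsSolution.initial_le_integral_mul_radialEigenfunction (h : IsSolution p R f g ε T u v)
    (hn : 1 ≤ n) (hpq : p.HolderConjugate q) (hτ : 0 < τ) (hτT : τ < T) :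
    ε * ((∫ x, f x * radialEigenfunction n x) + ∫ x, g x * radialEigenfunction n x)
      ≤ ∫ t in (0 : ℝ)..τ, (∫ x, u t x * radialEigenfunction n x) *
          (Real.exp (-t) * (deriv (deriv (timeCutoff q j τ)) t
            - 2 * deriv (timeCutoff q j τ) t)) := by
  have hq := hpq.symm.lt.le
  set η := timeCutoff q j τ
  have hη : ContDiff ℝ 2 η := contDiff_timeCutoff hq
  have hητ : η τ = 0 := timeCutoff_self hpq.symm.pos hτ.ne'
  have hη0 : η 0 = 1 := timeCutoff_zero
  have hφ0 : 0 ≤ radialEigenfunction n := fun x =>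
    zero_le_one.trans (one_le_radialEigenfunction hn x)
  have hθ' := deriv_exp_neg_mul (hη.differentiable two_ne_zero)
  have htest := h.integral_mul_eigenfunction_eq (c := 1) hpq.pos hτ hτT
    (contDiff_radialEigenfunction hn) hφ0
    (fun x => by rw [laplacian_radialEigenfunction hn, one_mul])
    (θ := fun t => Real.exp (-t) * η t) ((Real.contDiff_exp.comp contDiff_neg).mul hη)
    (by rw [hητ, mul_zero])
    (by rw [hθ', hητ, deriv_timeCutoff_self hq hτ.ne', sub_self, mul_zero])
  have hθ0 : Real.exp (-0) * η 0 = 1 := by rw [hη0, neg_zero, Real.exp_zero, one_mul]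
  have hθ'0 : deriv (fun t => Real.exp (-t) * η t) 0 = -1 := by
    rw [hθ', deriv_timeCutoff_zero hq, hη0, neg_zero, Real.exp_zero, one_mul, zero_sub]
  have hpos : 0 ≤ ∫ t in (0 : ℝ)..τ,
      (∫ x, |u t x| ^ p * radialEigenfunction n x) * (Real.exp (-t) * η t) := by
    refine intervalIntegral.integral_nonneg hτ.le fun t ht => mul_nonneg ?_ ?_
    · exact integral_nonneg fun x => mul_nonneg (by positivity) (hφ0 x)
    · exact mul_nonneg (Real.exp_pos _).le (timeCutoff_nonneg ht)
  have hθ'' (t : ℝ) : deriv (deriv fun t => Real.exp (-t) * η t) t - 1 * (Real.exp (-t) * η t)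
      = Real.exp (-t) * (deriv (deriv η) t - 2 * deriv η t) := by
    rw [deriv_deriv_exp_neg_mul hη]
    ring
  simp only [hθ'', hθ0, hθ'0] at htest
  linarith

lemma exists_initial_le_mul_integral_add (hn : 1 ≤ n) (hpq : p.HolderConjugate q) (hR : 0 ≤ R)
    (hs : s = (n - 1) * (1 - q / 2)) (hj : |s| ≤ j * q) :
    ∃ C > 0, ∀ (f g : L2 n) (u v : ℝ → L2 n) (ε T τ lam : ℝ), IsSolution p R f g ε T u v →
      1 ≤ τ → τ < T → 0 < lam →
        ε * ((∫ x, f x * radialEigenfunction n x) + ∫ x, g x * radialEigenfunction n x)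
          ≤ lam ^ p / p * (∫ t in (0 : ℝ)..τ, (∫ x, |u t x| ^ p) * timeCutoff q j τ t)
            + lam ^ (-q) * (C * τ ^ (s + 1 - q)) := by
  obtain ⟨B, hB, hBη⟩ := exists_abs_exp_neg_mul_deriv_timeCutoff_le hpq j
  obtain ⟨C, hC, hCφ⟩ :=
    exists_integral_mul_radialEigenfunction_rpow_le hn hpq.symm.pos hR hB hs hj
  refine ⟨C / q, div_pos hC hpq.symm.pos, fun f g u v ε T τ lam h hτ hτT hlam => ?_⟩
  have hτ0 : 0 < τ := by linarith
  set η := timeCutoff q j τ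
  have hη : ContDiff ℝ 2 η := contDiff_timeCutoff hpq.symm.lt.le
  have hcont : Continuous fun t => Real.exp (-t) * (deriv (deriv η) t - 2 * deriv η t) :=
    (Real.continuous_exp.comp continuous_neg).mul ((hη.iterate_deriv' 0 2).continuous.sub
      (continuous_const.mul (hη.continuous_deriv one_le_two)))
  have hφ0 : 0 ≤ radialEigenfunction n := fun x =>
    zero_le_one.trans (one_le_radialEigenfunction hn x)
  refine ((h.initial_le_integral_mul_radialEigenfunction hn hpq hτ0 hτT).trans
    (h.integral_mul_le_young hpq hτ0.le hτT hlam (contDiff_radialEigenfunction hn).continuous hφ0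
      hcont hη.continuous (fun t ht => ?_) (fun _ => timeCutoff_nonneg)
      (hBη τ hτ) (hCφ τ hτ))).trans_eq ?_
  · have ht0 := ht.1
    positivity
  · rw [add_sub_right_comm, Real.rpow_add_one hτ0.ne']
    ring

end Estimates

section Lifespan

variable {n : ℕ} {p q R ε T κ : ℝ} {f g : L2 n} {u v : ℝ → L2 n}

lemma gamma_pos (hn : 2 ≤ n) (hp : 1 < p) (hp0 : p < straussExponent n) : 0 < gamma p n := by
  have hn' : (2 : ℝ) ≤ n := by exact_mod_cast hn
  set r := Real.sqrt ((n : ℝ) ^ 2 + 10 * n - 7) with hr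
  have hr2 : r ^ 2 = (n : ℝ) ^ 2 + 10 * n - 7 := Real.sq_sqrt (by nlinarith)
  have hnr : (n : ℝ) + 1 ≤ r := Real.le_sqrt_of_sq_le (by nlinarith)
  have hfactor : ((n : ℝ) + 1 + r - 2 * (n - 1) * p) * (r - (n + 1) + 2 * (n - 1) * p)
      = 4 * (n - 1) * gamma p n := by
    rw [gamma]
    linear_combination hr2
  rw [straussExponent, ← hr, lt_div_iff₀ (by linarith)] at hp0
  have hprod : 0 < 4 * ((n : ℝ) - 1) * gamma p n :=
    hfactor ▸ mul_pos (by linarith) (by nlinarith)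
  exact pos_of_mul_pos_right hprod (by linarith)

lemma exponents_eq_neg_gamma_div {σ : ℝ} (hpq : p.HolderConjugate q) (n : ℕ)
    (hσ : σ = (q - 1 - (n - 1) * q / 2) / (p + q)) :
    σ * p + (n + 1 - 2 * q) = -(gamma p n / (2 * p * (p - 1))) ∧
      σ * -q + ((n - 1) * (1 - q / 2) + 1 - q) = -(gamma p n / (2 * p * (p - 1))) := by
  have hp := hpq.pos
  have hp1 := hpq.sub_one_pos
  have hsum : p + q = p ^ 2 / (p - 1) := by
    rw [hpq.conjugate_eq]
    field_simp
    ring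
  rw [hσ, hsum, hpq.conjugate_eq, gamma]
  constructor <;> field_simp <;> ring

lemma exists_initial_le_rpow (hn : 1 ≤ n) (hp : 1 < p) (hR : 0 ≤ R) :
    ∃ K > 0, ∀ (f g : L2 n) (u v : ℝ → L2 n) (ε T τ : ℝ), 0 ≤ g → 0 ≤ ε →
      IsSolution p R f g ε T u v → 1 ≤ τ → τ < T →
        ε * ((∫ x, f x * radialEigenfunction n x) + ∫ x, g x * radialEigenfunction n x)
          ≤ K * τ ^ (-(gamma p n / (2 * p * (p - 1)))) := by
  obtain ⟨q, hpq⟩ : ∃ q, p.HolderConjugate q := ⟨_, .conjExponent hp⟩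
  set s : ℝ := (n - 1) * (1 - q / 2) with hs
  have hj : |s| ≤ ⌈|s| / q⌉₊ * q := (div_le_iff₀ hpq.symm.pos).1 (Nat.le_ceil _)
  obtain ⟨C₁, hC₁, hX⟩ := exists_integral_abs_rpow_mul_timeCutoff_le n hpq hR ⌈|s| / q⌉₊
  obtain ⟨C₂, hC₂, hI⟩ := exists_initial_le_mul_integral_add hn hpq hR hs hj
  refine ⟨C₁ / p + C₂, add_pos (div_pos hC₁ hpq.pos) hC₂, fun f g u v ε T τ hg hε h hτ hτT => ?_⟩
  have hτ0 : 0 < τ := by linarith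
  -- this choice of `λ = τ ^ σ` gives the two terms on the right of `hI` the same power of `τ`
  set σ : ℝ := (q - 1 - (n - 1) * q / 2) / (p + q) with hσ
  obtain ⟨hσ₁, hσ₂⟩ := exponents_eq_neg_gamma_div hpq n hσ
  refine (hI f g u v ε T τ (τ ^ σ) h hτ hτT (by positivity)).trans ?_
  rw [add_mul, ← Real.rpow_mul hτ0.le, ← Real.rpow_mul hτ0.le]
  refine add_le_add ?_ (le_of_eq ?_)
  · calc τ ^ (σ * p) / p * _ ≤ τ ^ (σ * p) / p * (C₁ * τ ^ (n + 1 - 2 * q)) := by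
          gcongr
          exact hX f g u v ε T τ hg hε h hτ hτT
      _ = C₁ / p * τ ^ (-(gamma p n / (2 * p * (p - 1)))) := by
          rw [← hσ₁, Real.rpow_add hτ0]
          ring
  · rw [← hσ₂, Real.rpow_add hτ0]
    ring

lemma integral_mul_pos {w : L2 n} {φ : Space n → ℝ} (hw : 0 ≤ w) (hw0 : w ≠ 0)
    (hφ : ∀ x, 0 < φ x) (hwφ : Integrable fun x => w x * φ x) : 0 < ∫ x, w x * φ x := by
  have hnonneg : 0 ≤ᵐ[volume] fun x => w x * φ x := by
    filter_upwards [(Lp.coeFn_nonneg w).2 hw] with x hx using mul_nonneg hx (hφ x).le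
  refine (integral_nonneg_of_ae hnonneg).lt_of_ne' fun h0 => hw0 ?_
  rw [Lp.eq_zero_iff_ae_eq_zero]
  filter_upwards [(integral_eq_zero_iff_of_nonneg_ae hnonneg hwφ).1 h0] with x hx
  exact (mul_eq_zero.1 hx).resolve_right (hφ x).ne'

lemma integrable_mul_of_smul {w : L2 n} {ψ : Space n → ℝ} (hε : ε ≠ 0)
    (h : Integrable fun x => (ε • w : L2 n) x * ψ x) : Integrable fun x => w x * ψ x := by
  refine (h.const_mul ε⁻¹).congr ?_
  filter_upwards [Lp.coeFn_smul ε w] with x hx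
  rw [hx, Pi.smul_apply, smul_eq_mul, mul_assoc, inv_mul_cancel_left₀ hε]

lemma IsSolution.integral_initial_pos (h : IsSolution p R f g ε T u v) (hT : 0 < T) (hε : ε ≠ 0)
    (hf : 0 ≤ f) (hg : 0 ≤ g) (hfg : f ≠ 0 ∨ g ≠ 0) {φ : Space n → ℝ} (hφ : Continuous φ)
    (hφ0 : ∀ x, 0 < φ x) : 0 < (∫ x, f x * φ x) + ∫ x, g x * φ x := by
  obtain ⟨hu, hv⟩ := h.integrable_mul ⟨le_rfl, hT⟩ hφ
  rw [h.initial_u] at hu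
  rw [h.initial_v] at hv
  have hnonneg {w : L2 n} (hw : 0 ≤ w) : 0 ≤ ∫ x, w x * φ x := by
    refine integral_nonneg_of_ae ?_
    filter_upwards [(Lp.coeFn_nonneg w).2 hw] with x hx using mul_nonneg hx (hφ0 x).le
  rcases hfg with hf0 | hg0
  · exact add_pos_of_pos_of_nonneg
      (integral_mul_pos hf hf0 hφ0 (integrable_mul_of_smul hε hu)) (hnonneg hg)
  · exact add_pos_of_nonneg_of_pos (hnonneg hf)
      (integral_mul_pos hg hg0 hφ0 (integrable_mul_of_smul hε hv))

lemma le_max_one_div_rpow {a b : ℝ} (ha : 0 < a) (hκ : 0 < κ)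
    (h : ∀ τ, 1 ≤ τ → τ < T → a ≤ b * τ ^ (-κ⁻¹)) : T ≤ max 1 ((b / a) ^ κ) := by
  refine le_of_forall_lt_imp_le_of_dense fun τ hτT => ?_
  rcases le_total τ 1 with hτ | hτ
  · exact hτ.trans (le_max_left _ _)
  · have hτ0 : 0 < τ := by linarith
    have hτκ := h τ hτ hτT
    rw [Real.rpow_neg hτ0.le, ← div_eq_mul_inv, le_div_comm₀ ha (by positivity)] at hτκ
    calc τ = (τ ^ κ⁻¹) ^ κ := (Real.rpow_inv_rpow hτ0.le hκ.ne').symm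
      _ ≤ (b / a) ^ κ := by gcongr
      _ ≤ max 1 ((b / a) ^ κ) := le_max_right _ _

lemma max_one_div_mul_rpow_le {b c : ℝ} (hb : 0 ≤ b) (hc : 0 ≤ c) (hε : 0 < ε) (hε1 : ε ≤ 1)
    (hκ : 0 ≤ κ) : max 1 ((b / (ε * c)) ^ κ) ≤ max 1 ((b / c) ^ κ) * ε ^ (-κ) := by
  have hε1κ : 1 ≤ ε ^ (-κ) :=
    Real.one_le_rpow_of_pos_of_le_one_of_nonpos hε hε1 (neg_nonpos.2 hκ)
  rw [max_mul_of_nonneg _ _ (by positivity), one_mul]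
  refine max_le_max hε1κ (le_of_eq ?_)
  rw [mul_comm ε, ← div_div, Real.div_rpow (by positivity) hε.le, Real.rpow_neg hε.le,
    div_eq_mul_inv]

end Lifespan

end

end SemilinearWave

open SemilinearWave in
theorem theorem3p2_general (n : ℕ) (hn : 1 ≤ n) (p : ℝ) (hp : 1 < p) (hγ : 0 < gamma p n) (R : ℝ)
    (hR : 0 ≤ R) (f g : L2 n) (hf : 0 ≤ f) (hg : 0 ≤ g) (hfg : f ≠ 0 ∨ g ≠ 0) :
    ∃ ε₁ : ℝ, 0 < ε₁ ∧ ∃ C : ℝ, 0 < C ∧ ∀ ε : ℝ, 0 < ε → ε ≤ ε₁ →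
      lifespan p R f g ε ≤ ENNReal.ofReal (C * ε ^ (-(2 * p * (p - 1) / gamma p n))) := by
  obtain ⟨K, hK, hinitial⟩ := exists_initial_le_rpow hn hp hR
  set c := (∫ x, f x * radialEigenfunction n x) + ∫ x, g x * radialEigenfunction n x
  set κ := 2 * p * (p - 1) / gamma p n with hκ
  have hκ0 : 0 < κ := div_pos (mul_pos (by linarith) (by linarith)) hγ
  refine ⟨1, one_pos, max 1 ((K / c) ^ κ), by positivity, fun ε hε hε1 => sSup_le ?_⟩
  rintro _ ⟨T, ⟨hT, u, v, h⟩, rfl⟩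
  have hc : 0 < c := h.integral_initial_pos hT hε.ne' hf hg hfg
    (contDiff_radialEigenfunction hn).continuous
    fun x => one_pos.trans_le (one_le_radialEigenfunction hn x)
  have hT_le : T ≤ max 1 ((K / (ε * c)) ^ κ) :=
    le_max_one_div_rpow (mul_pos hε hc) hκ0 fun τ hτ hτT => by
      rw [hκ, inv_div]
      exact hinitial f g u v ε T τ hg hε.le h hτ hτT
  exact ENNReal.ofReal_le_ofReal <|
    hT_le.trans (max_one_div_mul_rpow_le hK.le hc.le hε hε1 hκ0.le)

theorem theorem3p2 (n : ℕ) (hn : 2 ≤ n) (p : ℝ) (hp : 1 < p)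
    (hp0 : p < SemilinearWave.straussExponent n) (R : ℝ) (hR : 0 < R)
    (f : SemilinearWave.L2 n) (hfH1 : SemilinearWave.MemH1 f) (hf : 0 ≤ f) (hf0 : f ≠ 0) :
    ∃ ε₁ : ℝ, 0 < ε₁ ∧ ∃ C : ℝ, 0 < C ∧ ∀ ε : ℝ, 0 < ε → ε ≤ ε₁ →
      SemilinearWave.lifespan p R f 0 ε ≤
        ENNReal.ofReal (C * ε ^ (-(2 * p * (p - 1) / SemilinearWave.gamma p n))) :=
  theorem3p2_general n (one_le_two.trans hn) p hp (SemilinearWave.gamma_pos hn hp hp0) R hR.le f 0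
    hf le_rfl (Or.inl hf0)
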